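/- **Setup.** Let $X\subseteq\{0,1\}^{\mathbb N}$ be the *ordered prime shift*: the set of all one-sided sequences in which none of the following words occurs: the words $10^n1$ with $n\ge 0$ not prime, and the words $10^{p_1}10^{p_2}1\cdots 0^{p_r}1$ with $r\ge 2$, all $p_i$ prime, and $p_i\ge p_{i+1}$ for some $i$. Let $\sigma$ be the shift map on $X$, and for words $u,v$ put $$Z(u,v)=\{(x,|u|-|v|,y): x,y\in X,\ x\text{ begins with }u,\ y\text{ begins with }v,\ \sigma^{|u|}(x)=\sigma^{|v|}(y)\}.$$ The *Renault–Deaconu groupoid* is $\mathcal G_X=\{(x,m-n,y)\in X\times\mathbb Z\times X:\ m,n\ge 0,\ \sigma^m(x)=\sigma^n(y)\}$, with $(x,k,y)(y,l,z)=(x,k+l,z)$, $(x,k,y)^{-1}=(y,-k,x)$, units $(x,0,x)$, and the topology with basis the sets $Z(u,v)$. Let $S=\bigcup_{a\in\{0,1\}} Z(a,\emptyset)\cup Z(\emptyset,a)$, and let $\ell_S(g)=0$ if $g$ is a unit and $\ell_S(g)=\min\{k\ge 1: g\in S^k\}$ otherwise. The *cover groupoid* $\hat{\mathcal G}_X$ is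 the following. Let $\hat X$ be the closure, in the Fell topology on closed subsets of $\mathcal G_X$, of the set of all source fibres $(\mathcal G_X)_x$, $x\in X$, with the empty set removed (equivalently, $\hat X$ is the spectrum of the commutative $C^*$-algebra of functions on $X$ generated by $x\mapsto\sum_{g\in(\mathcal G_X)_x}f(g)$, $f\in C_c(\mathcal G_X)$). Then $\hat{\mathcal G}_X=\{(g,A): A\in\hat X,\ g\in A\}$, with the subspace topology of $\mathcal G_X\times\hat X$; the arrow $(g,A)$ has source $(s(g),A)$, range $(r(g),Ag^{-1})$ and inverse $(g^{-1},Ag^{-1})$, and $(h,Ag^{-1})(g,A)=(hg,A)$. Put $\ell(g,A)=\ell_S(g)$. **Theorem.** $\hat{\mathcal G}_X$ is an étale groupoid, i.e. a locally compact Hausdorff topological groupoid whose range and source maps are local homeomorphisms. The function $\ell$ is a length function on it (nonnegative, zero on units, invariant under inversion, subadditive on products) that is bounded on compact sets. With respect to $\ell$, $\hat{\mathcal G}_X$ has strong subexponential growth but not polynomial growth. That is, writing $b(t)=\sup_u|\{\gamma\in\hat{\mathcal G}_X: s(\gamma)=u,\ \ell(\gamma)\le t\}|$, the supremum running over all units $u$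 of $\hat{\mathcal G}_X$: 1. there are $\alpha>0$, $0<\beta<1$ and $C>0$ such that $b(t)\le C\exp(\alpha t^\beta)$ for all $t\ge 0$; 2. there are no $C>0$ and $d\in\mathbb N$ such that $b(t)\le C(1+t)^d$ for all $t\ge 0$. -/

import Mathlib

open Set Filter Topology
open scoped ENNReal

/-! ### Groupoids, length functions and growth -/

/-- A groupoid, given by its set `G` of arrows, with partially defined multiplication.
The units are those arrows `u` with `r u = u`. -/
class ArrowGroupoid (G : Type*) where
  r : G → G
  s : G → G
  inv : G → G
  mul : (g h : G) → s g = r h → G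
  s_r : ∀ g, s (r g) = r g
  r_s : ∀ g, r (s g) = s g
  r_inv : ∀ g, r (inv g) = s g
  s_inv : ∀ g, s (inv g) = r g
  r_mul : ∀ g h (e : s g = r h), r (mul g h e) = r g
  s_mul : ∀ g h (e : s g = r h), s (mul g h e) = s h
  mul_assoc : ∀ g h k (e : s g = r h) (e' : s h = r k),
    mul (mul g h e) k ((s_mul g h e).trans e') = mul g (mul h k e') (e.trans (r_mul h k e').symm)
  r_mul_self : ∀ g (e : s (r g) = r g), mul (r g) g e = g
  mul_s_self : ∀ g (e : s g = r (s g)), mul g (s g) e = g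
  mul_inv : ∀ g, mul g (inv g) (r_inv g).symm = r g
  inv_mul : ∀ g, mul (inv g) g (s_inv g) = s g

namespace ArrowGroupoid

/-- The unit space of `G`. -/
def unitSpace (G : Type*) [ArrowGroupoid G] : Set G := {u | r u = u}

/-- The fibre `G_u` of arrows with source `u`. -/
def sourceFibre {G : Type*} [ArrowGroupoid G] (u : G) : Set G := {g | s g = u}

/-- The product of two sets of arrows. -/
def setMul {G : Type*} [ArrowGroupoid G] (A B : Set G) : Set G :=
  {x | ∃ a ∈ A, ∃ b ∈ B, ∃ e : s a = r b, mul a b e = x}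

/-- The powers of a set of arrows, with `S ^ 0` the unit space, so that `S ^ 1 = S`. -/
def setPow {G : Type*} [ArrowGroupoid G] (S : Set G) : ℕ → Set G
  | 0 => unitSpace G
  | k + 1 => setMul (setPow S k) S

open Classical in
/-- The length function attached to a generating set `S`: it vanishes on units, and for
other arrows `g` it is the least `k ≥ 1` with `g ∈ S ^ k`. -/
noncomputable def wordLength {G : Type*} [ArrowGroupoid G] (S : Set G) (g : G) : ℝ :=
  if g ∈ unitSpace G then 0 else ((sInf {k : ℕ | 1 ≤ k ∧ g ∈ setPow S k} : ℕ) : ℝ)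

/-- Length functions on a groupoid. -/
structure IsLengthFunction {G : Type*} [ArrowGroupoid G] (l : G → ℝ) : Prop where
  nonneg : ∀ g, 0 ≤ l g
  unit : ∀ u ∈ unitSpace G, l u = 0
  inv : ∀ g, l (inv g) = l g
  mul : ∀ g h (e : s g = r h), l (mul g h e) ≤ l g + l h

/-- A length function is locally bounded if it is bounded on compact sets. -/
def IsLocallyBounded {G : Type*} [TopologicalSpace G] (l : G → ℝ) : Prop :=
  ∀ K : Set G, IsCompact K → ∃ M : ℝ, ∀ g ∈ K, l g ≤ M

/-- The ball of radius `t` in the source fibre of the unit `u`. -/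
def ball {G : Type*} [ArrowGroupoid G] (l : G → ℝ) (u : G) (t : ℝ) : Set G :=
  {g | s g = u ∧ l g ≤ t}

/-- The supremum over all units `u` of the cardinality of the ball of radius `t` at `u`. -/
noncomputable def maxBall {G : Type*} [ArrowGroupoid G] (l : G → ℝ) (t : ℝ) : ℝ≥0∞ :=
  ⨆ u ∈ unitSpace G, ((ball l u t).encard : ℝ≥0∞)

/-- Polynomial growth with respect to `l`. -/
def HasPolynomialGrowth {G : Type*} [ArrowGroupoid G] (l : G → ℝ) : Prop :=
  ∃ C : ℝ, 0 < C ∧ ∃ d : ℕ, ∀ t : ℝ, 0 ≤ t → maxBall l t ≤ ENNReal.ofReal (C * (1 + t) ^ d)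

/-- Strong subexponential growth with respect to `l`. -/
def HasStrongSubexponentialGrowth {G : Type*} [ArrowGroupoid G] (l : G → ℝ) : Prop :=
  ∃ α β C : ℝ, 0 < α ∧ 0 < β ∧ β < 1 ∧ 0 < C ∧
    ∀ t : ℝ, 0 ≤ t → maxBall l t ≤ ENNReal.ofReal (C * Real.exp (α * t ^ β))

/-- Topological groupoids: multiplication and inversion are continuous. -/
class IsTopologicalGroupoid (G : Type*) [TopologicalSpace G] [ArrowGroupoid G] : Prop where
  continuous_inv : Continuous (inv : G → G)
  continuous_mul : Continuous fun p : {p : G × G // s p.1 = r p.2} => mul p.1.1 p.1.2 p.2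

/-- Étale groupoids: locally compact Hausdorff topological groupoids whose range and source
maps are local homeomorphisms. -/
structure IsEtale (G : Type*) [TopologicalSpace G] [ArrowGroupoid G] : Prop where
  t2 : T2Space G
  locallyCompact : LocallyCompactSpace G
  topological : IsTopologicalGroupoid G
  isLocalHomeomorph_r : IsLocalHomeomorph (r : G → G)
  isLocalHomeomorph_s : IsLocalHomeomorph (s : G → G)

theorem mul_congr {G : Type*} [ArrowGroupoid G] {g g' h h' : G} (hg : g = g') (hh : h = h')
    (e : s g = r h) (e' : s g' = r h') : mul g h e = mul g' h' e' := by
  subst hg; subst hh; rfl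

theorem s_s {G : Type*} [ArrowGroupoid G] (g : G) : s (s g) = s g := by
  have := s_r (inv g)
  rwa [r_inv] at this

theorem r_r {G : Type*} [ArrowGroupoid G] (g : G) : r (r g) = r g := by
  have := r_s (inv g)
  rwa [s_inv] at this

theorem inv_inv {G : Type*} [ArrowGroupoid G] (g : G) : inv (inv g) = g := by
  have e1 : s (inv (inv g)) = r (inv g) := s_inv _
  have h1 : mul (inv (inv g)) (s g) (by rw [s_inv, r_inv, r_s]) = inv (inv g) := by
    rw [mul_congr rfl (by rw [s_inv, r_inv] : s g = s (inv (inv g))) _ (r_s _).symm]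
    exact mul_s_self _ _
  have h2 := mul_assoc (inv (inv g)) (inv g) g e1 (s_inv g)
  rw [mul_congr rfl (inv_mul g) _ (by rw [s_inv, r_inv, r_s]), h1] at h2
  rw [← h2, mul_congr ((inv_mul (inv g)).trans (s_inv g)) rfl _ (s_r g)]
  exact r_mul_self g _

theorem mul_inv_cancel_right {G : Type*} [ArrowGroupoid G] (h g : G) (e : s h = r g)
    (e' : s (mul h g e) = r (inv g)) : mul (mul h g e) (inv g) e' = h := by
  have h1 := mul_assoc h g (inv g) e (r_inv g).symm
  rw [h1, mul_congr rfl ((mul_inv g).trans e.symm) _ (r_s h).symm]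
  exact mul_s_self h _

theorem inv_mul_cancel_right {G : Type*} [ArrowGroupoid G] (k g : G) (e : s k = r (inv g))
    (e' : s (mul k (inv g) e) = r g) : mul (mul k (inv g) e) g e' = k := by
  have h1 := mul_assoc k (inv g) g e (s_inv g)
  have e2 : s g = s k := by rw [e, r_inv]
  rw [h1, mul_congr rfl ((inv_mul g).trans e2) _ (r_s k).symm]
  exact mul_s_self k _

/-! ### The Fell topology -/

/-- The closed subsets of `G`. -/
structure FellSpace (G : Type*) [TopologicalSpace G] where
  carrier : Set G
  isClosed : IsClosed carrier

@[ext] theorem FellSpace.ext {G : Type*} [TopologicalSpace G] {A B : FellSpace G}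
    (h : ∀ g, g ∈ A.carrier ↔ g ∈ B.carrier) : A = B := by
  cases A; cases B; congr; exact Set.ext h

/-- The Fell topology on closed sets, generated by the sets `{A | A ∩ U ≠ ∅}` for `U` open and
`{A | A ∩ K = ∅}` for `K` compact. -/
instance FellSpace.instTopologicalSpace (G : Type*) [TopologicalSpace G] :
    TopologicalSpace (FellSpace G) :=
  TopologicalSpace.generateFrom
    ({W | ∃ U : Set G, IsOpen U ∧ W = {A | (A.carrier ∩ U).Nonempty}} ∪
     {W | ∃ K : Set G, IsCompact K ∧ W = {A | Disjoint A.carrier K}})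

theorem FellSpace.ultrafilter_le_nhds_iff {G : Type*} [TopologicalSpace G] [T2Space G]
    [LocallyCompactSpace G] {F : Ultrafilter (FellSpace G)} {A : FellSpace G} :
    (F : Filter (FellSpace G)) ≤ 𝓝 A ↔
      ∀ g, g ∈ A.carrier ↔ ∀ U ∈ 𝓝 g, ∀ᶠ B in (F : Filter (FellSpace G)),
        (B.carrier ∩ U).Nonempty := by
  have key : (F : Filter (FellSpace G)) ≤ 𝓝 A ↔ ∀ W ∈
      ({W | ∃ U : Set G, IsOpen U ∧ W = {A | (A.carrier ∩ U).Nonempty}} ∪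
       {W | ∃ K : Set G, IsCompact K ∧ W = {A | Disjoint A.carrier K}} :
        Set (Set (FellSpace G))), A ∈ W → W ∈ (F : Filter (FellSpace G)) :=
    TopologicalSpace.tendsto_nhds_generateFrom_iff (m := id)
  rw [key]
  constructor
  · intro h g
    constructor
    · intro hg U hU
      obtain ⟨V, hVU, hV, hgV⟩ := mem_nhds_iff.1 hU
      filter_upwards [h _ (Or.inl ⟨V, hV, rfl⟩) ⟨g, hg, hgV⟩] with B hB
      exact hB.mono (inter_subset_inter_right _ hVU)
    · intro hg
      by_contra hgA
      obtain ⟨K, hK, hKA, hKc⟩ := local_compact_nhds (A.isClosed.isOpen_compl.mem_nhds hgA)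
      have h1 := h _ (Or.inr ⟨K, hKc, rfl⟩)
        (Set.disjoint_left.2 fun a ha haK => hKA haK ha)
      obtain ⟨B, hB1, hB2⟩ := (Filter.Eventually.and h1 (hg K hK)).exists
      exact (Set.not_disjoint_iff_nonempty_inter.2 hB2) hB1
  · rintro h W (⟨U, hU, rfl⟩ | ⟨K, hK, rfl⟩) hA
    · obtain ⟨g, hg, hgU⟩ := hA
      exact (h g).1 hg U (hU.mem_nhds hgU)
    · have hloc : ∀ g ∈ K, ∃ U ∈ 𝓝[K] g, ∀ᶠ B in (F : Filter (FellSpace G)),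
          Disjoint B.carrier U := by
        intro g hg
        have : g ∉ A.carrier := fun hgA => Set.disjoint_left.1 hA hgA hg
        rw [h g] at this
        push Not at this
        obtain ⟨U, hU, hF⟩ := this
        refine ⟨U, mem_nhdsWithin_of_mem_nhds hU, ?_⟩
        filter_upwards [hF] with B hB
        exact Set.disjoint_iff_inter_eq_empty.2 hB
      refine hK.induction_on (p := fun U => ∀ᶠ B in (F : Filter (FellSpace G)),
          Disjoint B.carrier U) ?_ ?_ ?_ hloc
      · simp
      · intro s t hst ht
        filter_upwards [ht] with B hB
        exact hB.mono_right hst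
      · intro s t hs ht
        filter_upwards [hs, ht] with B h1 h2
        exact Set.disjoint_union_right.2 ⟨h1, h2⟩

/-! ### The cover groupoid -/

section Cover

variable {G : Type*} [TopologicalSpace G] [ArrowGroupoid G]

theorem continuous_r [IsTopologicalGroupoid G] : Continuous (r : G → G) := by
  have h1 : Continuous fun g : G => (⟨(g, inv g), (r_inv g).symm⟩ :
      {p : G × G // s p.1 = r p.2}) :=
    Continuous.subtype_mk (continuous_id.prodMk IsTopologicalGroupoid.continuous_inv) _
  have h2 := IsTopologicalGroupoid.continuous_mul.comp h1
  refine h2.congr fun g => ?_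
  exact mul_inv g

theorem continuous_s [IsTopologicalGroupoid G] : Continuous (s : G → G) := by
  refine (continuous_r.comp (IsTopologicalGroupoid.continuous_inv (G := G))).congr fun g => ?_
  exact r_inv g

/-- Continuity of multiplication in terms of neighbourhoods. -/
theorem mul_mem_of_nhds [IsTopologicalGroupoid G] {g h : G} (e : s g = r h) {U : Set G}
    (hU : U ∈ 𝓝 (mul g h e)) : ∃ V ∈ 𝓝 g, ∃ W ∈ 𝓝 h, ∀ v ∈ V, ∀ w ∈ W,
      ∀ e' : s v = r w, mul v w e' ∈ U := by
  have h1 := (IsTopologicalGroupoid.continuous_mul (G := G)).continuousAt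
    (x := ⟨(g, h), e⟩) hU
  rw [Filter.mem_map, nhds_subtype_eq_comap, Filter.mem_comap] at h1
  obtain ⟨T, hT, hTU⟩ := h1
  rw [nhds_prod_eq, Filter.mem_prod_iff] at hT
  obtain ⟨V, hV, W, hW, hVW⟩ := hT
  refine ⟨V, hV, W, hW, fun v hv w hw e' => ?_⟩
  exact hTU (show (⟨(v, w), e'⟩ : {p : G × G // s p.1 = r p.2}) ∈ _ from hVW ⟨hv, hw⟩)

/-- The fibre `G_u` as a closed subset of `G`. -/
def closedFibre [IsTopologicalGroupoid G] [T2Space G] (u : G) : FellSpace G where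
  carrier := sourceFibre u
  isClosed := isClosed_singleton.preimage continuous_s

/-- The translate `A g⁻¹` of a closed set `A`. -/
def translate [IsTopologicalGroupoid G] [T2Space G] (A : FellSpace G) (g : G) : FellSpace G where
  carrier := {h | ∃ e : s h = r g, mul h g e ∈ A.carrier}
  isClosed := by
    have h0 : IsClosed {h : G | s h = r g} := isClosed_singleton.preimage continuous_s
    have h1 : Continuous fun h : {h : G // s h = r g} =>
        (⟨(h.1, g), h.2⟩ : {p : G × G // s p.1 = r p.2}) :=
      Continuous.subtype_mk (continuous_subtype_val.prodMk continuous_const) _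
    have h2 := A.isClosed.preimage (IsTopologicalGroupoid.continuous_mul.comp h1)
    have h3 := h0.isClosedEmbedding_subtypeVal.isClosedMap _ h2
    convert h3 using 1
    ext h
    simp [Function.comp]

variable [IsTopologicalGroupoid G] [T2Space G]

variable (G) in
/-- The closure of the set of all source fibres in the Fell topology. Its nonempty members form
the unit space `X̂` of the cover of `G`, the spectrum of the commutative C*-algebra generated by
the functions `x ↦ ∑ f g`, summing over the arrows `g` with source `x`, for `f` continuous with
compact support on `G`: a character `χ` of that algebra corresponds to the closed set `A` with
`χ (x ↦ ∑ f g) = ∑ f g`, the sum on the right over `g ∈ A`. -/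
def limitFibres : Set (FellSpace G) := closure (closedFibre '' unitSpace G)

theorem s_eq_of_mem_limitFibres {A : FellSpace G} (hA : A ∈ limitFibres G) {g h : G}
    (hg : g ∈ A.carrier) (hh : h ∈ A.carrier) : s g = s h := by
  by_contra hne
  obtain ⟨U, V, hU, hV, hgU, hhV, hd⟩ := t2_separation hne
  have hopen : IsOpen ({B : FellSpace G | (B.carrier ∩ s ⁻¹' U).Nonempty} ∩
      {B : FellSpace G | (B.carrier ∩ s ⁻¹' V).Nonempty}) :=
    IsOpen.inter
      (TopologicalSpace.isOpen_generateFrom_of_mem (Or.inl ⟨_, hU.preimage continuous_s, rfl⟩))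
      (TopologicalSpace.isOpen_generateFrom_of_mem (Or.inl ⟨_, hV.preimage continuous_s, rfl⟩))
  obtain ⟨B, ⟨⟨a, ha, haU⟩, ⟨b, hb, hbV⟩⟩, ⟨u, _, rfl⟩⟩ :=
    mem_closure_iff.1 hA _ hopen ⟨⟨g, hg, hgU⟩, ⟨h, hh, hhV⟩⟩
  have ha' : s a = u := ha
  have hb' : s b = u := hb
  have haU' : s a ∈ U := haU
  have hbV' : s b ∈ V := hbV
  rw [ha'] at haU'
  rw [hb'] at hbV'
  exact Set.disjoint_left.1 hd haU' hbV'

/-- If `g ∈ A` and `A` is a limit of fibres, then `A` is a limit of fibres `G_{s h}` along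
an ultrafilter of arrows `h` converging to `g`. -/
theorem exists_ultrafilter {A : FellSpace G} (hA : A ∈ limitFibres G) {g : G}
    (hg : g ∈ A.carrier) : ∃ F : Ultrafilter G, (F : Filter G) ≤ 𝓝 g ∧
      ((F.map fun h => closedFibre (s h) : Ultrafilter (FellSpace G)) :
        Filter (FellSpace G)) ≤ 𝓝 A := by
  have hne : (𝓝 g ⊓ comap (fun h => closedFibre (s h)) (𝓝 A)).NeBot := by
    rw [Filter.inf_neBot_iff]
    rintro U hU T ⟨W, hW, hWT⟩
    obtain ⟨V, hVU, hV, hgV⟩ := mem_nhds_iff.1 hU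
    have hVo : {B : FellSpace G | (B.carrier ∩ V).Nonempty} ∈ 𝓝 A :=
      (TopologicalSpace.isOpen_generateFrom_of_mem (Or.inl ⟨V, hV, rfl⟩)).mem_nhds ⟨g, hg, hgV⟩
    obtain ⟨B, ⟨⟨a, ha, haV⟩, hBW⟩, ⟨u, _, rfl⟩⟩ :=
      mem_closure_iff_nhds.1 hA _ (Filter.inter_mem hVo hW)
    have ha' : s a = u := ha
    refine ⟨a, hVU haV, hWT ?_⟩
    simpa [ha'] using hBW
  obtain ⟨F, hF⟩ := @Ultrafilter.exists_le _ _ hne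
  exact ⟨F, hF.trans inf_le_left, Filter.map_le_iff_le_comap.2 (hF.trans inf_le_right)⟩

theorem translate_mul (A : FellSpace G) (h g : G) (e : s h = r g) :
    translate A (mul h g e) = translate (translate A g) h := by
  ext k
  constructor
  · rintro ⟨e1, hk⟩
    have e2 : s k = r h := by rw [e1, r_mul]
    refine ⟨e2, by rw [s_mul, e], ?_⟩
    rwa [mul_assoc k h g e2 e]
  · rintro ⟨e1, e2, hk⟩
    refine ⟨by rw [r_mul, e1], ?_⟩
    rwa [mul_assoc k h g e1 e] at hk

theorem translate_unit {A : FellSpace G} (hA : A ∈ limitFibres G) {g : G}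
    (hg : g ∈ A.carrier) : translate A (s g) = A := by
  ext h
  constructor
  · rintro ⟨e, hh⟩
    have e1 : s g = s h := by rw [e, r_s]
    rw [mul_congr rfl e1 e (r_s h).symm] at hh
    rwa [mul_s_self] at hh
  · intro hh
    have e1 : s h = s g := s_eq_of_mem_limitFibres hA hh hg
    refine ⟨by rw [r_s, e1], ?_⟩
    rw [mul_congr rfl e1.symm _ (r_s h).symm, mul_s_self]
    exact hh

theorem r_mem_translate {A : FellSpace G} {g : G} (hg : g ∈ A.carrier) :
    r g ∈ (translate A g).carrier :=
  ⟨s_r g, by rwa [r_mul_self]⟩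

theorem translate_translate_inv {A : FellSpace G} (hA : A ∈ limitFibres G) {g : G}
    (hg : g ∈ A.carrier) : translate (translate A g) (inv g) = A := by
  rw [← translate_mul A (inv g) g (s_inv g), inv_mul]
  exact translate_unit hA hg

variable [LocallyCompactSpace G]

theorem s_mem_of_mem_limitFibres {A : FellSpace G} (hA : A ∈ limitFibres G) {g : G}
    (hg : g ∈ A.carrier) : s g ∈ A.carrier := by
  obtain ⟨F, hF, hFA⟩ := exists_ultrafilter hA hg
  rw [FellSpace.ultrafilter_le_nhds_iff.1 hFA]
  intro U hU
  have := hF (continuous_s.continuousAt hU)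
  refine Filter.mem_map.2 ?_
  filter_upwards [this] with h hh
  exact ⟨s h, s_s h, hh⟩

theorem translate_mem_limitFibres {A : FellSpace G} (hA : A ∈ limitFibres G) {g : G}
    (hg : g ∈ A.carrier) : translate A g ∈ limitFibres G := by
  obtain ⟨F, hF, hFA⟩ := exists_ultrafilter hA hg
  have hFA' := FellSpace.ultrafilter_le_nhds_iff.1 hFA
  refine mem_closure_iff_ultrafilter.2 ⟨F.map fun h => closedFibre (r h), ?_, ?_⟩
  · exact Filter.mem_map.2 (Filter.univ_mem' fun h => ⟨r h, r_r h, rfl⟩)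
  · rw [FellSpace.ultrafilter_le_nhds_iff]
    intro k
    constructor
    · rintro ⟨e, hk⟩ U hU
      have e1 : s (mul k g e) = r (inv g) := by rw [s_mul, r_inv]
      rw [← mul_inv_cancel_right k g e e1] at hU
      obtain ⟨V, hV, W, hW, hVW⟩ := mul_mem_of_nhds e1 hU
      have h1 := Filter.mem_map.1 ((hFA' _).1 hk V hV)
      have h2 := hF (IsTopologicalGroupoid.continuous_inv.continuousAt hW)
      refine Filter.mem_map.2 ?_
      filter_upwards [h1, h2] with h hh1 hh2
      obtain ⟨v, hv, hvV⟩ := hh1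
      have e2 : s v = r (inv h) := by rw [r_inv]; exact hv
      refine ⟨mul v (inv h) e2, ?_, hVW v hvV _ hh2 e2⟩
      exact (s_mul _ _ _).trans (s_inv h)
    · intro hk
      have e : s k = r g := by
        by_contra hne
        obtain ⟨U, V, hU, hV, hkU, hgV, hd⟩ := t2_separation hne
        have h1 := Filter.mem_map.1 (hk _ ((hU.preimage continuous_s).mem_nhds hkU))
        have h2 := hF ((hV.preimage continuous_r).mem_nhds hgV)
        obtain ⟨h, ⟨v, hv, hvU⟩, hh2⟩ := (Filter.Eventually.and h1 h2).exists
        have hv' : s v = r h := hv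
        have hvU' : s v ∈ U := hvU
        rw [hv'] at hvU'
        exact Set.disjoint_left.1 hd hvU' hh2
      refine ⟨e, (hFA' _).2 fun U hU => ?_⟩
      obtain ⟨V, hV, W, hW, hVW⟩ := mul_mem_of_nhds e hU
      have h1 := Filter.mem_map.1 (hk V hV)
      have h2 := hF hW
      refine Filter.mem_map.2 ?_
      filter_upwards [h1, h2] with h hh1 hh2
      obtain ⟨v, hv, hvV⟩ := hh1
      exact ⟨mul v h hv, s_mul _ _ _, hVW v hvV h hh2 hv⟩


variable (G) in
/-- The cover `Ĝ` of `G`: the transformation groupoid of pairs `(g, A)` where the point `A` of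
`X̂` contains the arrow `g`, with the topology of `G × X̂`. -/
def Cover : Type _ :=
  {p : G × FellSpace G // p.2 ∈ limitFibres G ∧ p.1 ∈ p.2.carrier}

instance : TopologicalSpace (Cover G) :=
  inferInstanceAs (TopologicalSpace
    {p : G × FellSpace G // p.2 ∈ limitFibres G ∧ p.1 ∈ p.2.carrier})

theorem inv_mem_translate {A : FellSpace G} (hA : A ∈ limitFibres G) {g : G}
    (hg : g ∈ A.carrier) : inv g ∈ (translate A g).carrier :=
  ⟨s_inv g, by rw [inv_mul]; exact s_mem_of_mem_limitFibres hA hg⟩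

/-- The arrow `(g, A)` has source the unit `(s g, A)` and range the unit `(r g, A g⁻¹)`; the
product of `(h, A g⁻¹)` and `(g, A)` is `(h g, A)`. -/
instance : ArrowGroupoid (Cover G) where
  r p := ⟨(r p.1.1, translate p.1.2 p.1.1),
    translate_mem_limitFibres p.2.1 p.2.2, r_mem_translate p.2.2⟩
  s p := ⟨(s p.1.1, p.1.2), p.2.1, s_mem_of_mem_limitFibres p.2.1 p.2.2⟩
  inv p := ⟨(inv p.1.1, translate p.1.2 p.1.1),
    translate_mem_limitFibres p.2.1 p.2.2, inv_mem_translate p.2.1 p.2.2⟩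
  mul p q e := ⟨(mul p.1.1 q.1.1 (congrArg (fun z => z.1.1) e), q.1.2), q.2.1, by
    have h1 : p.1.2 = translate q.1.2 q.1.1 := congrArg (fun z => z.1.2) e
    have h2 := p.2.2
    rw [h1] at h2
    exact h2.2⟩
  s_r p := Subtype.ext (Prod.ext (s_r _) rfl)
  r_s p := Subtype.ext (Prod.ext (r_s _) (translate_unit p.2.1 p.2.2))
  r_inv p := Subtype.ext (Prod.ext (r_inv _) (translate_translate_inv p.2.1 p.2.2))
  s_inv p := Subtype.ext (Prod.ext (s_inv _) rfl)
  r_mul p q e := Subtype.ext (Prod.ext (r_mul _ _ _) (by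
    have h1 : p.1.2 = translate q.1.2 q.1.1 := congrArg (fun z => z.1.2) e
    show translate q.1.2 (mul p.1.1 q.1.1 _) = translate p.1.2 p.1.1
    rw [translate_mul, h1]))
  s_mul p q e := Subtype.ext (Prod.ext (s_mul _ _ _) rfl)
  mul_assoc p q t e e' := Subtype.ext (Prod.ext (mul_assoc _ _ _ _ _) rfl)
  r_mul_self p e := Subtype.ext (Prod.ext (r_mul_self _ _) rfl)
  mul_s_self p e := Subtype.ext (Prod.ext (mul_s_self _ _) rfl)
  mul_inv p := Subtype.ext (Prod.ext (mul_inv _) rfl)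
  inv_mul p := Subtype.ext (Prod.ext (inv_mul _) rfl)

/-- The length function on the cover induced by a length function on `G`. -/
def coverLength (l : G → ℝ) (p : Cover G) : ℝ := l p.1.1

end Cover

end ArrowGroupoid

/-! ### Shift spaces and their Renault–Deaconu groupoids -/

/-- The shift map on one-sided sequences (indexed from `0`). -/
def shiftMap {A : Type*} (x : ℕ → A) : ℕ → A := fun n => x (n + 1)

/-- The word of length `n` occurring in `x` at position `k`. -/
def wordAt {A : Type*} (x : ℕ → A) (k n : ℕ) : List A := List.ofFn fun i : Fin n => x (k + i)

/-- A one-sided shift space over the alphabet `A`. -/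
structure ShiftSpace (A : Type*) [TopologicalSpace A] where
  carrier : Set (ℕ → A)
  isClosed : IsClosed carrier
  mapsTo : MapsTo shiftMap carrier carrier

/-- The shift space of all sequences in which no word of `F` occurs. -/
def ShiftSpace.ofForbidden {A : Type*} [TopologicalSpace A] [DiscreteTopology A]
    (F : Set (List A)) : ShiftSpace A where
  carrier := {x | ∀ k n, wordAt x k n ∉ F}
  isClosed := by
    simp only [Set.ofPred_forall]
    refine isClosed_iInter fun k => isClosed_iInter fun n => ?_
    have h : Continuous fun (x : ℕ → A) (i : Fin n) => x (k + i) := by fun_prop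
    exact (isClosed_discrete {w : Fin n → A | List.ofFn w ∉ F}).preimage h
  mapsTo := by
    intro x hx k n
    have h := hx (k + 1) n
    have e : wordAt (shiftMap x) k n = wordAt x (k + 1) n := by
      simp only [wordAt, shiftMap, Nat.add_right_comm]
    rwa [e]

/-- The arrows `(x, m - n, y)` of the Renault–Deaconu groupoid of `X`. -/
@[ext] structure RenaultDeaconu {A : Type*} [TopologicalSpace A] (X : ShiftSpace A) where
  left : X.carrier
  lag : ℤ
  right : X.carrier
  tail_eq : ∃ m n : ℕ, lag = (m : ℤ) - n ∧ shiftMap^[m] left.1 = shiftMap^[n] right.1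

namespace RenaultDeaconu

theorem shiftMap_iterate {A : Type*} (n : ℕ) (x : ℕ → A) (i : ℕ) :
    (shiftMap^[n] x) i = x (i + n) := by
  induction n generalizing x with
  | zero => rfl
  | succ n ih => rw [Function.iterate_succ_apply, ih]; simp [shiftMap, Nat.add_assoc]

theorem wordAt_eq_iff {A : Type*} {x y : ℕ → A} {n : ℕ} :
    wordAt x 0 n = wordAt y 0 n ↔ ∀ i < n, x i = y i := by
  simp only [wordAt, List.ofFn_inj, funext_iff, Nat.zero_add]
  exact ⟨fun h i hi => h ⟨i, hi⟩, fun h i => h i i.2⟩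

variable {A : Type*} [TopologicalSpace A] {X : ShiftSpace A}

/-- `(x, k, y) (y, l, z) = (x, k + l, z)` and `(x, k, y)⁻¹ = (y, -k, x)`; the units are the
arrows `(x, 0, x)`. -/
instance : ArrowGroupoid (RenaultDeaconu X) where
  r g := ⟨g.left, 0, g.left, 0, 0, by simp, rfl⟩
  s g := ⟨g.right, 0, g.right, 0, 0, by simp, rfl⟩
  inv g := ⟨g.right, -g.lag, g.left, by
    obtain ⟨m, n, h, e⟩ := g.tail_eq
    exact ⟨n, m, by omega, e.symm⟩⟩
  mul g h e := ⟨g.left, g.lag + h.lag, h.right, by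
    have e1 : g.right = h.left := congrArg RenaultDeaconu.left e
    obtain ⟨m, n, h1, h2⟩ := g.tail_eq
    obtain ⟨k, l, h3, h4⟩ := h.tail_eq
    refine ⟨m + k, n + l, by push_cast; omega, ?_⟩
    rw [Nat.add_comm m k, Function.iterate_add_apply, h2, e1, ← Function.iterate_add_apply,
      Nat.add_comm k n, Function.iterate_add_apply, h4, ← Function.iterate_add_apply]⟩
  s_r _ := rfl
  r_s _ := rfl
  r_inv _ := rfl
  s_inv _ := rfl
  r_mul _ _ _ := rfl
  s_mul _ _ _ := rfl
  mul_assoc _ _ _ _ _ := RenaultDeaconu.ext rfl (add_assoc _ _ _) rfl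
  r_mul_self _ _ := RenaultDeaconu.ext rfl (zero_add _) rfl
  mul_s_self _ _ := RenaultDeaconu.ext rfl (add_zero _) rfl
  mul_inv _ := RenaultDeaconu.ext rfl (add_neg_cancel _) rfl
  inv_mul _ := RenaultDeaconu.ext rfl (neg_add_cancel _) rfl

/-- The cylinder set `Z(w)`. -/
def cylinder (X : ShiftSpace A) (w : List A) : Set X.carrier :=
  {x | wordAt x.1 0 w.length = w}

/-- The set `Z(u, v)` of arrows `(x, |u| - |v|, y)` with `x ∈ Z(u)`, `y ∈ Z(v)` and
`σ ^ |u| x = σ ^ |v| y`. -/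
def basicSet (X : ShiftSpace A) (u v : List A) : Set (RenaultDeaconu X) :=
  {g | g.lag = (u.length : ℤ) - v.length ∧
    shiftMap^[u.length] g.left.1 = shiftMap^[v.length] g.right.1 ∧
    g.left ∈ cylinder X u ∧ g.right ∈ cylinder X v}

/-- The topology with basis the sets `Z(u, v)`. -/
instance : TopologicalSpace (RenaultDeaconu X) :=
  TopologicalSpace.generateFrom {Z | ∃ u v : List A, Z = basicSet X u v}

/-- The canonical generating set, the union of the sets `Z(a, ∅)` and `Z(∅, a)` over all
letters `a`. -/
def generators (X : ShiftSpace A) : Set (RenaultDeaconu X) :=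
  ⋃ a : A, basicSet X [a] [] ∪ basicSet X [] [a]

/-- The basic set given by the first `m` letters of `x` and the first `n` letters of `y`. -/
theorem mem_basicSet_wordAt {x y : ℕ → A} {m n : ℕ} {g : RenaultDeaconu X} :
    g ∈ basicSet X (wordAt x 0 m) (wordAt y 0 n) ↔ g.lag = (m : ℤ) - n ∧
      shiftMap^[m] g.left.1 = shiftMap^[n] g.right.1 ∧
      (∀ i < m, g.left.1 i = x i) ∧ ∀ i < n, g.right.1 i = y i := by
  have hl : ∀ (z : ℕ → A) (k : ℕ), (wordAt z 0 k).length = k := by simp [wordAt]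
  simp only [basicSet, cylinder, Set.mem_ofPred_eq, hl, wordAt_eq_iff]

theorem isOpen_basicSet (u v : List A) : IsOpen (basicSet X u v) :=
  TopologicalSpace.isOpen_generateFrom_of_mem ⟨u, v, rfl⟩

/-- Arrows have arbitrarily long presentations. -/
theorem exists_tail_eq (g : RenaultDeaconu X) (N : ℕ) : ∃ m n : ℕ, N ≤ m ∧ N ≤ n ∧
    g.lag = (m : ℤ) - n ∧ shiftMap^[m] g.left.1 = shiftMap^[n] g.right.1 := by
  obtain ⟨m, n, h1, h2⟩ := g.tail_eq
  refine ⟨N + m, N + n, by omega, by omega, by push_cast; omega, ?_⟩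
  rw [Function.iterate_add_apply, h2, Function.iterate_add_apply]

/-- An arrow that is close to a point of `Z(u, v)` lies in `Z(u, v)`. -/
theorem mem_basicSet_of_close {u v : List A} {g g' : RenaultDeaconu X} (hg : g ∈ basicSet X u v)
    {m n : ℕ} (hm : u.length ≤ m) (hlag : g.lag = (m : ℤ) - n)
    (hlag' : g'.lag = (m : ℤ) - n) (htail : shiftMap^[m] g'.left.1 = shiftMap^[n] g'.right.1)
    (hl : ∀ i < m, g'.left.1 i = g.left.1 i) (hr : ∀ i < n, g'.right.1 i = g.right.1 i) :
    g' ∈ basicSet X u v := by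
  obtain ⟨h1, h2, h3, h4⟩ := hg
  refine ⟨by omega, ?_, ?_, ?_⟩
  · funext i
    have h2i := congrFun h2 i
    simp only [shiftMap_iterate] at h2i ⊢
    by_cases hi : i + u.length < m
    · rw [hl _ hi, hr _ (by omega), h2i]
    · have h5 := congrFun htail (i + u.length - m)
      simp only [shiftMap_iterate] at h5
      have e1 : i + u.length - m + m = i + u.length := by omega
      have e2 : i + u.length - m + n = i + v.length := by omega
      rwa [e1, e2] at h5
  · exact (wordAt_eq_iff.2 fun i hi => hl i (by omega)).trans h3
  · exact (wordAt_eq_iff.2 fun i hi => hr i (by omega)).trans h4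

instance : ArrowGroupoid.IsTopologicalGroupoid (RenaultDeaconu X) where
  continuous_inv := by
    refine continuous_generateFrom_iff.2 ?_
    rintro _ ⟨u, v, rfl⟩
    have e : (ArrowGroupoid.inv : RenaultDeaconu X → _) ⁻¹' basicSet X u v = basicSet X v u := by
      ext g
      constructor
      · rintro ⟨h1, h2, h3, h4⟩
        have h1' : -g.lag = (u.length : ℤ) - v.length := h1
        exact ⟨by omega, h2.symm, h4, h3⟩
      · rintro ⟨h1, h2, h3, h4⟩
        refine ⟨?_, h2.symm, h4, h3⟩
        show -g.lag = (u.length : ℤ) - v.length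
        omega
    rw [e]
    exact isOpen_basicSet v u
  continuous_mul := by
    refine continuous_generateFrom_iff.2 ?_
    rintro _ ⟨u, v, rfl⟩
    refine isOpen_iff_mem_nhds.2 ?_
    rintro ⟨⟨g, h⟩, e⟩ hgh
    have e0 : g.right = h.left := congrArg RenaultDeaconu.left e
    obtain ⟨m, n, hm, hn, h1, h2⟩ := exists_tail_eq g u.length
    obtain ⟨k, l, hk, hl, h3, h4⟩ := exists_tail_eq h v.length
    have h2' : shiftMap^[m + k] g.left.1 = shiftMap^[n + k] g.right.1 := by
      rw [Nat.add_comm m, Nat.add_comm n, Function.iterate_add_apply, h2,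
        Function.iterate_add_apply]
    have h4' : shiftMap^[n + k] h.left.1 = shiftMap^[n + l] h.right.1 := by
      rw [Function.iterate_add_apply, h4, Function.iterate_add_apply]
    have hU := (isOpen_basicSet (X := X) (wordAt g.left.1 0 (m + k))
      (wordAt g.right.1 0 (n + k))).mem_nhds (x := g)
      (mem_basicSet_wordAt.2 ⟨by push_cast; omega, h2', fun _ _ => rfl, fun _ _ => rfl⟩)
    have hV := (isOpen_basicSet (X := X) (wordAt h.left.1 0 (n + k))
      (wordAt h.right.1 0 (n + l))).mem_nhds (x := h)
      (mem_basicSet_wordAt.2 ⟨by push_cast; omega, h4', fun _ _ => rfl, fun _ _ => rfl⟩)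
    rw [nhds_subtype_eq_comap, Filter.mem_comap]
    refine ⟨_, prod_mem_nhds hU hV, ?_⟩
    rintro ⟨⟨g', h'⟩, e'⟩ ⟨hg', hh'⟩
    have e0' : g'.right = h'.left := congrArg RenaultDeaconu.left e'
    obtain ⟨a1, a2, a3, a4⟩ := mem_basicSet_wordAt.1 hg'
    obtain ⟨b1, b2, b3, b4⟩ := mem_basicSet_wordAt.1 hh'
    simp only at a1 a2 a3 a4 b1 b2 b3 b4
    refine mem_basicSet_of_close (m := m + k) (n := n + l) hgh (by omega)
      ?_ ?_ ?_ a3 b4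
    · show g.lag + h.lag = _
      push_cast; omega
    · show g'.lag + h'.lag = _
      push_cast at a1 b1 ⊢; omega
    · show shiftMap^[m + k] g'.left.1 = shiftMap^[n + l] h'.right.1
      rw [a2, e0', b2]

instance : T2Space (RenaultDeaconu X) where
  t2 := by
    intro g h hne
    have key : ∃ N : ℕ, g.lag ≠ h.lag ∨ (∃ i < N, g.left.1 i ≠ h.left.1 i) ∨
        ∃ i < N, g.right.1 i ≠ h.right.1 i := by
      by_contra hcon
      push Not at hcon
      refine hne (RenaultDeaconu.ext (Subtype.ext (funext fun i => ?_)) (hcon 0).1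
        (Subtype.ext (funext fun i => ?_)))
      · exact (hcon (i + 1)).2.1 i (by omega)
      · exact (hcon (i + 1)).2.2 i (by omega)
    obtain ⟨N, hN⟩ := key
    obtain ⟨m, n, hm, hn, h1, h2⟩ := exists_tail_eq g N
    obtain ⟨k, l, hk, hl, h3, h4⟩ := exists_tail_eq h N
    refine ⟨_, _, isOpen_basicSet (wordAt g.left.1 0 m) (wordAt g.right.1 0 n),
      isOpen_basicSet (wordAt h.left.1 0 k) (wordAt h.right.1 0 l),
      mem_basicSet_wordAt.2 ⟨h1, h2, fun _ _ => rfl, fun _ _ => rfl⟩,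
      mem_basicSet_wordAt.2 ⟨h3, h4, fun _ _ => rfl, fun _ _ => rfl⟩, ?_⟩
    refine Set.disjoint_left.2 fun p hp hq => ?_
    obtain ⟨a1, -, a3, a4⟩ := mem_basicSet_wordAt.1 hp
    obtain ⟨b1, -, b3, b4⟩ := mem_basicSet_wordAt.1 hq
    rcases hN with hN | ⟨i, hi, hN⟩ | ⟨i, hi, hN⟩
    · exact hN (by omega)
    · exact hN ((a3 i (by omega)).symm.trans (b3 i (by omega)))
    · exact hN ((a4 i (by omega)).symm.trans (b4 i (by omega)))

theorem isCompact_basicSet [Finite A] [DiscreteTopology A] (u v : List A) :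
    IsCompact (basicSet X u v) := by
  have hX : CompactSpace X.carrier := isCompact_iff_compactSpace.1 X.isClosed.isCompact
  have hcoord : ∀ i : ℕ, Continuous fun x : X.carrier => x.1 i := fun i =>
    (continuous_apply i).comp continuous_subtype_val
  have hcyl : ∀ w : List A, IsClosed (cylinder X w) := by
    intro w
    have h : Continuous fun (x : X.carrier) (i : Fin w.length) => x.1 (0 + i) :=
      continuous_pi fun i => hcoord _
    exact (isClosed_discrete {f : Fin w.length → A | List.ofFn f = w}).preimage h
  have hcont : ∀ n : ℕ, Continuous fun x : X.carrier => shiftMap^[n] x.1 := by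
    intro n
    refine continuous_pi fun i => ?_
    simp only [shiftMap_iterate]
    exact hcoord _
  let T : Set (X.carrier × X.carrier) := {p | shiftMap^[u.length] p.1.1 = shiftMap^[v.length] p.2.1
    ∧ p.1 ∈ cylinder X u ∧ p.2 ∈ cylinder X v}
  have hT : IsClosed T :=
    (isClosed_eq ((hcont _).comp continuous_fst) ((hcont _).comp continuous_snd)).inter
      (((hcyl u).preimage continuous_fst).inter ((hcyl v).preimage continuous_snd))
  have hTc : CompactSpace T := isCompact_iff_compactSpace.1 hT.isCompact
  let f : T → RenaultDeaconu X := fun p =>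
    ⟨p.1.1, (u.length : ℤ) - v.length, p.1.2, u.length, v.length, rfl, p.2.1⟩
  have hf : Continuous f := by
    refine continuous_generateFrom_iff.2 ?_
    rintro _ ⟨u', v', rfl⟩
    refine isOpen_iff_mem_nhds.2 fun p hp => ?_
    have hlag : (u.length : ℤ) - v.length = u'.length - v'.length := hp.1
    let m := u.length + u'.length
    let n := v.length + u'.length
    have hopen : ∀ (N : ℕ) (x : X.carrier), {y : X.carrier | ∀ i < N, y.1 i = x.1 i} ∈ 𝓝 x := by
      intro N x
      have h := (Set.finite_lt_nat N).isOpen_biInter (f := fun i => {y : X.carrier | y.1 i = x.1 i})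
        (fun i _ => (isOpen_discrete {x.1 i}).preimage
          (hcoord i))
      filter_upwards [h.mem_nhds (Set.mem_iInter₂.2 fun i _ => rfl)] with y hy i hi
      exact Set.mem_iInter₂.1 hy i hi
    rw [nhds_subtype_eq_comap, Filter.mem_comap]
    refine ⟨_, prod_mem_nhds (hopen m p.1.1) (hopen n p.1.2), fun q hq => ?_⟩
    refine mem_basicSet_of_close (m := m) (n := n) hp (by omega) ?_ ?_ ?_ hq.1 hq.2
    · show (u.length : ℤ) - v.length = _
      omega
    · show (u.length : ℤ) - v.length = _
      omega
    · show shiftMap^[m] q.1.1.1 = shiftMap^[n] q.1.2.1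
      simp only [m, n]
      rw [Nat.add_comm u.length, Nat.add_comm v.length, Function.iterate_add_apply, q.2.1,
        ← Function.iterate_add_apply]
  have hr : basicSet X u v = Set.range f := by
    ext g
    constructor
    · rintro ⟨h1, h2, h3, h4⟩
      exact ⟨⟨(g.left, g.right), h2, h3, h4⟩, RenaultDeaconu.ext rfl h1.symm rfl⟩
    · rintro ⟨p, rfl⟩
      exact ⟨rfl, p.2.1, p.2.2.1, p.2.2.2⟩
  rw [hr]
  exact isCompact_range hf

instance [Finite A] [DiscreteTopology A] : LocallyCompactSpace (RenaultDeaconu X) := by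
  have : WeaklyLocallyCompactSpace (RenaultDeaconu X) := ⟨fun g => by
    obtain ⟨m, n, h1, h2⟩ := g.tail_eq
    exact ⟨_, isCompact_basicSet (X := X) (wordAt g.left.1 0 m) (wordAt g.right.1 0 n),
      (isOpen_basicSet _ _).mem_nhds
        (mem_basicSet_wordAt.2 ⟨h1, h2, fun _ _ => rfl, fun _ _ => rfl⟩)⟩⟩
  infer_instance

end RenaultDeaconu

/-! ### The ordered prime shift -/

/-- The word `1 0^(p₁) 1 0^(p₂) 1 … 0^(pᵣ) 1`. -/
def gapWord (p : List ℕ) : List (Fin 2) :=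
  1 :: p.flatMap fun n => List.replicate n 0 ++ [1]

/-- The forbidden words of the ordered prime shift: `1 0^n 1` with `n` not prime, and
`1 0^(p₁) 1 … 0^(pᵣ) 1` with `r ≥ 2`, all `pᵢ` prime, and `pᵢ ≥ pᵢ₊₁` for some `i`. -/
def primeForbidden : Set (List (Fin 2)) :=
  {w | ∃ n : ℕ, ¬ n.Prime ∧ w = gapWord [n]} ∪
  {w | ∃ p : List ℕ, 2 ≤ p.length ∧ (∀ q ∈ p, q.Prime) ∧
    (∃ (i : ℕ) (h : i + 1 < p.length), p[i + 1] ≤ p[i]) ∧ w = gapWord p}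

/-- The ordered prime shift. -/
def orderedPrimeShift : ShiftSpace (Fin 2) := ShiftSpace.ofForbidden primeForbidden

/-- The length function `(g, A) ↦ l_S g` on the cover of the Renault–Deaconu groupoid of the
ordered prime shift, with `S` the canonical generating set. -/
noncomputable def primeCoverLength :
    ArrowGroupoid.Cover (RenaultDeaconu orderedPrimeShift) → ℝ :=
  ArrowGroupoid.coverLength
    (ArrowGroupoid.wordLength (RenaultDeaconu.generators orderedPrimeShift))

/-! Étaleness. Write G for the groupoid of the shift. By the ultrafilter description of its limits,
the Fell space of G is compact Hausdorff, and the cover is closed in G × Fell(G), hence locally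
compact Hausdorff. The source map of G is locally injective, because on Z(u, v) the arrow is
determined by y. On the cover it also becomes open: if A contains g, then every A' close to A meets
a given neighbourhood of g, so arrows close to (g, A) exist over all units close to its source.

Upper bound. A product of k generators is an arrow (x, m - n, y) with m, n ≤ k and σ^m x = σ^n y.
Over a fixed unit of the cover, both y and A are fixed, so the arrow is determined by m, n and the
first m letters of x. The gaps between ones strictly increase, so these letters contain O(√m) ones
(`card_onesBelow_le`). Counting their positions gives t^O(√t) arrows, which is below C exp(α
t^(3/4)).

Lower bound. Over y = 000…, every set of k primes q ≤ N gives a sequence with these gaps followed by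
zeros, reached within length k(N + 1) + 1. So the ball has at least `π(N).choose k` elements
(`choose_le_maxBall`). With N = M², a Chebyshev estimate makes this at least M^k / k! at a radius of
order M², so degree d fails for k = 2d + 1. -/

namespace ArrowGroupoid

/-! ### Compactness of the Fell space -/

namespace FellSpace

variable {G : Type*} [TopologicalSpace G]

theorem isOpen_setOf_inter_nonempty {U : Set G} (hU : IsOpen U) :
    IsOpen {A : FellSpace G | (A.carrier ∩ U).Nonempty} :=
  TopologicalSpace.isOpen_generateFrom_of_mem (Or.inl ⟨U, hU, rfl⟩)

variable [T2Space G] [LocallyCompactSpace G]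

instance : T2Space (FellSpace G) := by
  refine t2_iff_ultrafilter.2 fun {A B} F hA hB => FellSpace.ext fun g => ?_
  rw [ultrafilter_le_nhds_iff.1 hA g, ultrafilter_le_nhds_iff.1 hB g]

/-- Every ultrafilter converges: its limit consists of the points all of whose neighbourhoods meet
almost every member. This set may be empty, which is why the empty set has to be a point of the Fell
space. -/
instance : CompactSpace (FellSpace G) := by
  refine ⟨isCompact_iff_ultrafilter_le_nhds.2 fun F _ => ?_⟩
  let A : FellSpace G :=
    ⟨{g | ∀ U ∈ 𝓝 g, ∀ᶠ B in (F : Filter (FellSpace G)), (B.carrier ∩ U).Nonempty}, by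
      refine isClosed_of_closure_subset fun g hg U hU => ?_
      obtain ⟨V, hVU, hV, hgV⟩ := mem_nhds_iff.1 hU
      obtain ⟨h, hhV, hh⟩ := mem_closure_iff.1 hg V hV hgV
      filter_upwards [hh V (hV.mem_nhds hhV)] with B hB
      exact hB.mono (inter_subset_inter_right _ hVU)⟩
  exact ⟨A, mem_univ _, ultrafilter_le_nhds_iff.2 fun g => Iff.rfl⟩

/-- This makes the cover a closed subspace of G × Fell(G). The empty limit is excluded by the
requirement g ∈ A. -/
theorem isClosed_setOf_mem : IsClosed {p : G × FellSpace G | p.1 ∈ p.2.carrier} := by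
  refine isClosed_iff_ultrafilter.2 fun p F hFp hF => ?_
  have h1 : Tendsto Prod.fst (F : Filter (G × FellSpace G)) (𝓝 p.1) :=
    (continuous_fst.tendsto p).mono_left hFp
  have h2 : ((F.map Prod.snd : Ultrafilter (FellSpace G)) : Filter (FellSpace G)) ≤ 𝓝 p.2 :=
    (continuous_snd.tendsto p).mono_left hFp
  refine (ultrafilter_le_nhds_iff.1 h2 p.1).2 fun U hU => Filter.mem_map.2 ?_
  filter_upwards [h1 hU, hF] with q hq hqm
  exact ⟨q.1, hqm, hq⟩

end FellSpace

end ArrowGroupoid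

/-! ### Étaleness of the cover -/

theorem IsLocallyInjective.isLocalHomeomorph {X Y : Type*} [TopologicalSpace X]
    [TopologicalSpace Y] {f : X → Y} (hi : IsLocallyInjective f) (hc : Continuous f)
    (ho : IsOpenMap f) : IsLocalHomeomorph f := by
  refine isLocalHomeomorph_iff_isOpenEmbedding_restrict.2 fun x => ?_
  obtain ⟨U, hU, hxU, hinj⟩ := hi x
  exact ⟨U, hU.mem_nhds hxU, IsOpenEmbedding.of_continuous_injective_isOpenMap
    (hc.comp continuous_subtype_val) (injOn_iff_injective.1 hinj)
    (ho.comp hU.isOpenMap_subtype_val)⟩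

namespace ArrowGroupoid

variable {G : Type*} [TopologicalSpace G] [ArrowGroupoid G] [IsTopologicalGroupoid G]
  [T2Space G]

namespace Cover

theorem continuous_arrow : Continuous fun p : Cover G => p.1.1 :=
  continuous_fst.comp continuous_subtype_val

theorem continuous_point : Continuous fun p : Cover G => p.1.2 :=
  continuous_snd.comp continuous_subtype_val

theorem isLocallyBounded {l : G → ℝ} (hl : IsLocallyBounded l) :
    IsLocallyBounded (coverLength l : Cover G → ℝ) := by
  intro K hK
  obtain ⟨M, hM⟩ := hl _ (hK.image continuous_arrow)
  exact ⟨M, fun p hp => hM _ ⟨p, hp, rfl⟩⟩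

variable [LocallyCompactSpace G]

instance : T2Space (Cover G) :=
  inferInstanceAs (T2Space {p : G × FellSpace G // p.2 ∈ limitFibres G ∧ p.1 ∈ p.2.carrier})

instance : LocallyCompactSpace (Cover G) := by
  have h : IsClosed {p : G × FellSpace G | p.2 ∈ limitFibres G ∧ p.1 ∈ p.2.carrier} :=
    (isClosed_closure.preimage continuous_snd).inter FellSpace.isClosed_setOf_mem
  exact h.isClosedEmbedding_subtypeVal.locallyCompactSpace

/-- The action of arrows on the points of the cover is continuous. -/
theorem continuous_translate : Continuous fun p : Cover G => translate p.1.2 p.1.1 := by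
  refine continuous_iff_ultrafilter.2 fun p F hFp => ?_
  have hg : Tendsto (fun q : Cover G => q.1.1) F (𝓝 p.1.1) :=
    (continuous_arrow.tendsto p).mono_left hFp
  have hA : ((F.map fun q : Cover G => q.1.2 : Ultrafilter (FellSpace G)) :
      Filter (FellSpace G)) ≤ 𝓝 p.1.2 := (continuous_point.tendsto p).mono_left hFp
  have hA' := FellSpace.ultrafilter_le_nhds_iff.1 hA
  change ((F.map fun q : Cover G => translate q.1.2 q.1.1 : Ultrafilter (FellSpace G)) :
      Filter (FellSpace G)) ≤ _
  rw [FellSpace.ultrafilter_le_nhds_iff]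
  intro k
  constructor
  · rintro ⟨e, hk⟩ U hU
    -- Since k = (k g) g⁻¹, an arrow v of a nearby A' close to k g, multiplied by the inverse of a
    -- nearby h, gives an arrow of A' h⁻¹ close to k.
    have e1 : s (mul k p.1.1 e) = r (inv p.1.1) := by rw [s_mul, r_inv]
    rw [← mul_inv_cancel_right k p.1.1 e e1] at hU
    obtain ⟨V, hV, W, hW, hVW⟩ := mul_mem_of_nhds e1 hU
    have h1 := Filter.mem_map.1 ((hA' _).1 hk V hV)
    have h2 := hg (IsTopologicalGroupoid.continuous_inv.continuousAt hW)
    refine Filter.mem_map.2 ?_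
    filter_upwards [h1, h2] with q hq1 hq2
    obtain ⟨v, hv, hvV⟩ := hq1
    have e2 : s v = r (inv q.1.1) := by
      rw [r_inv]
      exact s_eq_of_mem_limitFibres q.2.1 hv q.2.2
    have e3 : s (mul v (inv q.1.1) e2) = r q.1.1 := by rw [s_mul, s_inv]
    refine ⟨mul v (inv q.1.1) e2, ⟨e3, ?_⟩, hVW v hvV _ hq2 e2⟩
    rw [inv_mul_cancel_right v q.1.1 e2 e3]
    exact hv
  · intro hk
    -- Arrows v of A' h⁻¹ close to k satisfy s v = r h, and this passes to the limit because G is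
    -- Hausdorff. Then v h ∈ A' is close to k g.
    have e : s k = r p.1.1 := by
      by_contra hne
      obtain ⟨U, V, hU, hV, hkU, hgV, hd⟩ := t2_separation hne
      have h1 := Filter.mem_map.1 (hk _ ((hU.preimage continuous_s).mem_nhds hkU))
      have h2 := hg ((hV.preimage continuous_r).mem_nhds hgV)
      obtain ⟨q, ⟨v, ⟨hv, -⟩, hvU⟩, hq2⟩ := (Filter.Eventually.and h1 h2).exists
      have hvU' : s v ∈ U := hvU
      rw [hv] at hvU'
      exact Set.disjoint_left.1 hd hvU' hq2
    refine ⟨e, (hA' _).2 fun U hU => ?_⟩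
    obtain ⟨V, hV, W, hW, hVW⟩ := mul_mem_of_nhds e hU
    have h1 := Filter.mem_map.1 (hk V hV)
    have h2 := hg hW
    refine Filter.mem_map.2 ?_
    filter_upwards [h1, h2] with q hq1 hq2
    obtain ⟨v, ⟨hv, hvA⟩, hvV⟩ := hq1
    exact ⟨_, hvA, hVW v hvV _ hq2 hv⟩

instance : IsTopologicalGroupoid (Cover G) where
  continuous_inv := Continuous.subtype_mk
    ((IsTopologicalGroupoid.continuous_inv.comp continuous_arrow).prodMk continuous_translate) _
  continuous_mul := by
    refine Continuous.subtype_mk (Continuous.prodMk ?_ ?_) _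
    · have h : Continuous fun p : {p : Cover G × Cover G // s p.1 = r p.2} =>
          (⟨(p.1.1.1.1, p.1.2.1.1), congrArg (fun z => z.1.1) p.2⟩ :
            {p : G × G // s p.1 = r p.2}) :=
        Continuous.subtype_mk ((continuous_arrow.comp (continuous_fst.comp
          continuous_subtype_val)).prodMk (continuous_arrow.comp (continuous_snd.comp
          continuous_subtype_val))) _
      exact IsTopologicalGroupoid.continuous_mul.comp h
    · exact continuous_point.comp (continuous_snd.comp continuous_subtype_val)

theorem isLocallyInjective_s (hs : IsLocallyInjective (s : G → G)) :
    IsLocallyInjective (s : Cover G → Cover G) := by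
  intro p
  obtain ⟨U, hU, hpU, hinj⟩ := hs p.1.1
  refine ⟨_, hU.preimage continuous_arrow, hpU, fun q hq t ht e => ?_⟩
  exact Subtype.ext (Prod.ext (hinj hq ht (congrArg (fun z => z.1.1) e))
    (congrArg (fun z => z.1.2) e))

/-- Openness comes from the Fell topology, not from G: meeting a neighbourhood of g is an open
condition on A', so each A' near A supplies an arrow k near g, and (k, A') lies over the prescribed
unit. -/
theorem isOpenMap_s (hs : IsLocallyInjective (s : G → G)) :
    IsOpenMap (s : Cover G → Cover G) := by
  refine isOpenMap_iff_nhds_le.2 fun p T hT => ?_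
  have hT' := Filter.mem_map.1 hT
  obtain ⟨R, hR, hRT⟩ := (mem_nhds_subtype _ _ _).1 hT'
  rw [nhds_prod_eq, Filter.mem_prod_iff] at hR
  obtain ⟨V, hV, W, hW, hVW⟩ := hR
  obtain ⟨V', hVV, hV', hpV⟩ := mem_nhds_iff.1 hV
  -- A point q near the unit `s p` must itself be a unit: its arrow and the source of that arrow
  -- both lie in U and have the same source, and s is injective on U.
  obtain ⟨U, hU, hpU, hinj⟩ := hs (s p.1.1)
  have hsp : s (s p.1.1) ∈ U := by rwa [s_s]
  have h1 : ∀ᶠ q in 𝓝 (s p), q.1.1 ∈ U :=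
    continuous_arrow.continuousAt (hU.mem_nhds hpU)
  have h2 : ∀ᶠ q in 𝓝 (s p), s q.1.1 ∈ U :=
    (continuous_s.comp continuous_arrow).continuousAt (x := s p) (hU.mem_nhds hsp)
  have h3 : ∀ᶠ q in 𝓝 (s p), q.1.2 ∈ W := continuous_point.continuousAt (x := s p) hW
  have h4 : ∀ᶠ q in 𝓝 (s p), (q.1.2.carrier ∩ V').Nonempty :=
    continuous_point.continuousAt (x := s p)
      ((FellSpace.isOpen_setOf_inter_nonempty hV').mem_nhds ⟨p.1.1, p.2.2, hpV⟩)
  filter_upwards [h1, h2, h3, h4] with q hq1 hq2 hq3 ⟨k, hk, hkV⟩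
  have e1 : q.1.1 = s q.1.1 := hinj hq1 hq2 (s_s _).symm
  have e2 : s k = s q.1.1 := s_eq_of_mem_limitFibres q.2.1 hk q.2.2
  let q' : Cover G := ⟨(k, q.1.2), q.2.1, hk⟩
  have h5 : s q' ∈ T := hRT (hVW (Set.mk_mem_prod (hVV hkV) hq3))
  have e3 : s q' = q := Subtype.ext (Prod.ext (e2.trans e1.symm) rfl)
  rwa [← e3]

/-- The cover of a groupoid with locally injective source map is étale. -/
theorem isEtale (hs : IsLocallyInjective (s : G → G)) : IsEtale (Cover G) := by
  have h := (isLocallyInjective_s hs).isLocalHomeomorph continuous_s (isOpenMap_s hs)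
  have hc := IsTopologicalGroupoid.continuous_inv (G := Cover G)
  let e : Cover G ≃ₜ Cover G := ⟨⟨inv, inv, inv_inv, inv_inv⟩, hc, hc⟩
  have hr : (r : Cover G → Cover G) = s ∘ e := funext fun g => (s_inv g).symm
  exact ⟨inferInstance, inferInstance, inferInstance, hr ▸ h.comp e.isLocalHomeomorph, h⟩

theorem isLengthFunction {l : G → ℝ} (hl : IsLengthFunction l) :
    IsLengthFunction (coverLength l : Cover G → ℝ) where
  nonneg _ := hl.nonneg _
  unit _ hp := hl.unit _ (congrArg (fun z : Cover G => z.1.1) hp)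
  inv _ := hl.inv _
  mul _ _ _ := hl.mul _ _ _

end Cover

end ArrowGroupoid

/-! ### Word length of a symmetric generating set -/

namespace ArrowGroupoid

variable {G : Type*} [ArrowGroupoid G]

theorem setPow_add {S : Set G} {k l : ℕ} {g h : G} (hg : g ∈ setPow S k) (hh : h ∈ setPow S l)
    (e : s g = r h) : mul g h e ∈ setPow S (k + l) := by
  induction l generalizing h with
  | zero =>
    have hr : r h = h := hh
    have hs : h = s g := by rw [e, hr]
    subst hs
    rwa [mul_s_self]
  | succ l ih =>
    obtain ⟨a, ha, b, hb, e', rfl⟩ := hh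
    rw [← mul_assoc g a b (e.trans (r_mul a b e')) e']
    exact ⟨_, ih ha (e.trans (r_mul a b e')), b, hb, _, rfl⟩

theorem mem_setPow_one {S : Set G} {g : G} (hg : g ∈ S) : g ∈ setPow S 1 :=
  ⟨r g, r_r g, g, hg, s_r g, r_mul_self g _⟩

theorem inv_mul_rev (g h : G) (e : s g = r h) (e' : s (inv h) = r (inv g)) :
    inv (mul g h e) = mul (inv h) (inv g) e' := by
  have e1 : s (inv (mul g h e)) = r (mul g h e) := s_inv _
  have e2 : s (mul (inv h) (inv g) e') = r (mul g h e) := by rw [s_mul, s_inv, r_mul]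
  have h1 : mul (mul (inv h) (inv g) e') (mul g h e) e2 = s h := by
    have e3 : s (mul (inv h) (inv g) e') = r g := by rw [s_mul, s_inv]
    rw [← mul_assoc _ g h e3 e, mul_congr (inv_mul_cancel_right (inv h) g e' e3) rfl _ (s_inv h),
      inv_mul]
  have e4 : s (mul (mul (inv h) (inv g) e') (mul g h e) e2) = r (inv (mul g h e)) := by
    rw [s_mul, r_inv]
  have h2 := mul_inv_cancel_right (mul (inv h) (inv g) e') (mul g h e) e2 e4
  have e5 : s h = r (inv (mul g h e)) := by rw [r_inv, s_mul]
  rw [← h2, mul_congr (h1.trans e5) rfl _ (s_r _), r_mul_self]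

theorem inv_mem_setPow {S : Set G} (hS : ∀ g ∈ S, inv g ∈ S) {k : ℕ} {g : G}
    (hg : g ∈ setPow S k) : inv g ∈ setPow S k := by
  induction k generalizing g with
  | zero =>
    have hr : r g = g := hg
    show r (inv g) = inv g
    have h1 : mul (inv g) (s (inv g)) (r_s _).symm = mul (inv g) g (s_inv g) :=
      mul_congr rfl ((s_inv g).trans hr) _ _
    rw [mul_s_self, inv_mul] at h1
    rw [h1, r_s]
  | succ k ih =>
    obtain ⟨a, ha, b, hb, e, rfl⟩ := hg
    have e' : s (inv b) = r (inv a) := by rw [s_inv, r_inv, e]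
    rw [inv_mul_rev a b e e', Nat.add_comm]
    exact setPow_add (mem_setPow_one (hS b hb)) (ih ha) e'

theorem wordLength_le {S : Set G} {k : ℕ} {g : G} (hg : g ∈ setPow S k) :
    wordLength S g ≤ k := by
  unfold wordLength
  split_ifs with hu
  · positivity
  · have hk : 1 ≤ k := by
      rcases k with _ | k
      · exact absurd hg hu
      · omega
    exact_mod_cast Nat.sInf_le (show k ∈ {k : ℕ | 1 ≤ k ∧ g ∈ setPow S k} from ⟨hk, hg⟩)

/-- Since S generates, the infimum is attained, and the default value 0 of `sInf` on the empty set
never occurs. Units are covered by k = 0. -/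
theorem exists_mem_setPow_wordLength {S : Set G} (hS : ∀ g, ∃ k, g ∈ setPow S k) (g : G) :
    ∃ k : ℕ, wordLength S g = k ∧ g ∈ setPow S k := by
  unfold wordLength
  split_ifs with hu
  · exact ⟨0, by simp, hu⟩
  · obtain ⟨k, hk⟩ := hS g
    have hk1 : 1 ≤ k := by
      rcases k with _ | k
      · exact absurd hk hu
      · omega
    have hne : {k : ℕ | 1 ≤ k ∧ g ∈ setPow S k}.Nonempty := ⟨k, hk1, hk⟩
    exact ⟨_, rfl, (Nat.sInf_mem hne).2⟩

/-- The length function of a symmetric generating set. -/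
theorem isLengthFunction_wordLength {S : Set G} (hS : ∀ g, ∃ k, g ∈ setPow S k)
    (hinv : ∀ g ∈ S, inv g ∈ S) : IsLengthFunction (wordLength S) where
  nonneg g := by
    unfold wordLength
    split_ifs <;> positivity
  unit u hu := by
    unfold wordLength
    rw [if_pos hu]
  inv g := by
    have key : ∀ g : G, wordLength S (inv g) ≤ wordLength S g := fun g => by
      obtain ⟨k, hk, hg⟩ := exists_mem_setPow_wordLength hS g
      rw [hk]
      exact wordLength_le (inv_mem_setPow hinv hg)
    refine le_antisymm (key g) ?_
    simpa only [inv_inv] using key (inv g)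
  mul g h e := by
    obtain ⟨k, hk, hg⟩ := exists_mem_setPow_wordLength hS g
    obtain ⟨l, hl, hh⟩ := exists_mem_setPow_wordLength hS h
    rw [hk, hl]
    exact_mod_cast wordLength_le (setPow_add hg hh e)

end ArrowGroupoid

/-! ### Word length on the Renault–Deaconu groupoid -/

namespace RenaultDeaconu

open ArrowGroupoid

variable {A : Type*} [TopologicalSpace A] {X : ShiftSpace A}

/-- On Z(u, v) the left end is x = u σ^|v|(y) and the lag is constant, so y determines the arrow. -/
theorem isLocallyInjective_s :
    IsLocallyInjective (s : RenaultDeaconu X → RenaultDeaconu X) := by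
  intro g
  obtain ⟨m, n, h1, h2⟩ := g.tail_eq
  refine ⟨_, isOpen_basicSet (wordAt g.left.1 0 m) (wordAt g.right.1 0 n),
    mem_basicSet_wordAt.2 ⟨h1, h2, fun _ _ => rfl, fun _ _ => rfl⟩, fun a ha b hb e => ?_⟩
  obtain ⟨a1, a2, a3, -⟩ := mem_basicSet_wordAt.1 ha
  obtain ⟨b1, b2, b3, -⟩ := mem_basicSet_wordAt.1 hb
  have hr : (s a).right = (s b).right := congrArg RenaultDeaconu.right e
  refine RenaultDeaconu.ext (Subtype.ext (funext fun i => ?_)) (a1.trans b1.symm) hr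
  rcases lt_or_ge i m with hi | hi
  · rw [a3 i hi, b3 i hi]
  · have h := congrFun (a2.trans ((congrArg (fun z : X.carrier => shiftMap^[n] z.1) hr).trans
      b2.symm)) (i - m)
    simpa only [shiftMap_iterate, Nat.sub_add_cancel hi] using h

theorem mem_generators_iff {g : RenaultDeaconu X} : g ∈ generators X ↔
    (g.lag = 1 ∧ shiftMap g.left.1 = g.right.1) ∨
      (g.lag = -1 ∧ g.left.1 = shiftMap g.right.1) := by
  simp only [generators, mem_iUnion, mem_union, basicSet, cylinder, Set.mem_ofPred_eq]
  constructor
  · rintro ⟨a, ⟨h1, h2, -⟩ | ⟨h1, h2, -⟩⟩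
    · exact Or.inl ⟨by simpa using h1, h2⟩
    · exact Or.inr ⟨by simpa using h1, h2⟩
  · rintro (⟨h1, h2⟩ | ⟨h1, h2⟩)
    · exact ⟨g.left.1 0, Or.inl ⟨by simpa using h1, h2, by simp [wordAt], by simp [wordAt]⟩⟩
    · exact ⟨g.right.1 0, Or.inr ⟨by simpa using h1, h2, by simp [wordAt], by simp [wordAt]⟩⟩

theorem inv_mem_generators {g : RenaultDeaconu X} (hg : g ∈ generators X) :
    inv g ∈ generators X := by
  rw [mem_generators_iff] at hg ⊢
  rcases hg with ⟨h1, h2⟩ | ⟨h1, h2⟩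
  · exact Or.inr ⟨congrArg Neg.neg h1, h2.symm⟩
  · refine Or.inl ⟨?_, h2.symm⟩
    show -g.lag = 1
    omega

/-- The arrow factors into m generators of lag 1, shifting x down to the common tail, followed by n
generators of lag -1, building y up from it. -/
theorem mem_setPow_generators {m n : ℕ} {g : RenaultDeaconu X} (hlag : g.lag = (m : ℤ) - n)
    (htail : shiftMap^[m] g.left.1 = shiftMap^[n] g.right.1) :
    g ∈ setPow (generators X) (m + n) := by
  induction m generalizing g with
  | zero =>
    rw [Nat.zero_add]
    induction n generalizing g with
    | zero =>
      have h0 : (0 : ℤ) = g.lag := by simpa using hlag.symm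
      exact RenaultDeaconu.ext rfl h0 (Subtype.ext htail)
    | succ n ih =>
      let y : X.carrier := ⟨shiftMap g.right.1, X.mapsTo g.right.2⟩
      have hy : shiftMap^[0] g.left.1 = shiftMap^[n] y.1 := htail
      let a : RenaultDeaconu X := ⟨g.left, -n, y, 0, n, by simp, hy⟩
      let b : RenaultDeaconu X := ⟨y, -1, g.right, 0, 1, by simp, rfl⟩
      refine ⟨a, ih (by simp [a]) hy, b, mem_generators_iff.2 (Or.inr ⟨rfl, rfl⟩), rfl, ?_⟩
      refine RenaultDeaconu.ext rfl ?_ rfl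
      show -(n : ℤ) + -1 = g.lag
      rw [hlag]
      push_cast
      ring
  | succ m ih =>
    let y : X.carrier := ⟨shiftMap g.left.1, X.mapsTo g.left.2⟩
    have hy : shiftMap^[m] y.1 = shiftMap^[n] g.right.1 := htail
    let a : RenaultDeaconu X := ⟨g.left, 1, y, 1, 0, by simp, rfl⟩
    let b : RenaultDeaconu X := ⟨y, (m : ℤ) - n, g.right, m, n, rfl, hy⟩
    have ha : a ∈ generators X := mem_generators_iff.2 (Or.inl ⟨rfl, rfl⟩)
    have h := setPow_add (mem_setPow_one ha) (ih (g := b) rfl hy) rfl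
    have e : mul a b rfl = g := by
      refine RenaultDeaconu.ext rfl ?_ rfl
      show 1 + ((m : ℤ) - n) = g.lag
      rw [hlag]
      push_cast
      ring
    rwa [e, ← Nat.add_assoc, Nat.add_comm 1 m] at h

/-- Multiplying on the right by a generator of lag -1 raises n by one. One of lag 1 lowers n by one
or, when n = 0, raises m by one. -/
theorem exists_tail_eq_of_mem_setPow {k : ℕ} {g : RenaultDeaconu X}
    (hg : g ∈ setPow (generators X) k) : ∃ m n : ℕ, m ≤ k ∧ n ≤ k ∧ g.lag = (m : ℤ) - n ∧
      shiftMap^[m] g.left.1 = shiftMap^[n] g.right.1 := by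
  induction k generalizing g with
  | zero =>
    have h1 : (0 : ℤ) = g.lag := congrArg RenaultDeaconu.lag hg
    have h2 : g.left = g.right := congrArg RenaultDeaconu.right hg
    exact ⟨0, 0, le_rfl, le_rfl, by simpa using h1.symm, congrArg Subtype.val h2⟩
  | succ k ih =>
    obtain ⟨a, ha, b, hb, e, rfl⟩ := hg
    obtain ⟨m, n, hm, hn, h1, h2⟩ := ih ha
    have e' : a.right = b.left := congrArg RenaultDeaconu.left e
    rw [e'] at h2
    rcases mem_generators_iff.1 hb with ⟨h3, h4⟩ | ⟨h3, h4⟩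
    · rcases n with _ | n
      · refine ⟨m + 1, 0, by omega, by omega, ?_, ?_⟩
        · show a.lag + b.lag = _
          push_cast at h1 ⊢
          omega
        · show shiftMap^[m + 1] a.left.1 = b.right.1
          rw [Function.iterate_succ_apply', h2, ← h4]
          rfl
      · refine ⟨m, n, by omega, by omega, ?_, ?_⟩
        · show a.lag + b.lag = _
          push_cast at h1 ⊢
          omega
        · show shiftMap^[m] a.left.1 = shiftMap^[n] b.right.1
          rw [h2, ← h4]
          rfl
    · refine ⟨m, n + 1, by omega, by omega, ?_, ?_⟩
      · show a.lag + b.lag = _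
        push_cast
        omega
      · show shiftMap^[m] a.left.1 = shiftMap^[n + 1] b.right.1
        rw [h2, h4]
        rfl

theorem exists_mem_setPow_generators (g : RenaultDeaconu X) :
    ∃ k, g ∈ setPow (generators X) k := by
  obtain ⟨m, n, h1, h2⟩ := g.tail_eq
  exact ⟨_, mem_setPow_generators h1 h2⟩

theorem isLengthFunction_wordLength_generators :
    IsLengthFunction (wordLength (generators X)) :=
  isLengthFunction_wordLength exists_mem_setPow_generators fun _ => inv_mem_generators

/-- The length is at most |u| + |v| on the open set Z(u, v), and finitely many such sets cover a
compact set. -/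
theorem isLocallyBounded_wordLength_generators :
    IsLocallyBounded (wordLength (generators X)) := by
  intro K hK
  refine hK.induction_on (p := fun K => ∃ M : ℝ, ∀ g ∈ K, wordLength (generators X) g ≤ M)
    ⟨0, by simp⟩ ?_ ?_ ?_
  · rintro s t hst ⟨M, hM⟩
    exact ⟨M, fun g hg => hM g (hst hg)⟩
  · rintro s t ⟨M, hM⟩ ⟨N, hN⟩
    refine ⟨max M N, ?_⟩
    rintro g (hg | hg)
    · exact (hM g hg).trans (le_max_left _ _)
    · exact (hN g hg).trans (le_max_right _ _)
  · intro g _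
    obtain ⟨m, n, h1, h2⟩ := g.tail_eq
    refine ⟨_, mem_nhdsWithin_of_mem_nhds ((isOpen_basicSet (wordAt g.left.1 0 m)
      (wordAt g.right.1 0 n)).mem_nhds
      (mem_basicSet_wordAt.2 ⟨h1, h2, fun _ _ => rfl, fun _ _ => rfl⟩)), (m + n : ℕ), ?_⟩
    intro a ha
    obtain ⟨a1, a2, -⟩ := mem_basicSet_wordAt.1 ha
    exact wordLength_le (mem_setPow_generators a1 a2)

end RenaultDeaconu

/-! ### The ordered prime shift in terms of gaps -/

/-- The word `1 0^n 1` occurs in `x` at position `i`. -/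
def IsGap (x : ℕ → Fin 2) (i n : ℕ) : Prop :=
  x i = 1 ∧ (∀ l < n, x (i + 1 + l) = 0) ∧ x (i + n + 1) = 1

theorem gapWord_cons (n : ℕ) (p : List ℕ) :
    gapWord (n :: p) = (1 :: List.replicate n 0) ++ gapWord p := by
  simp [gapWord]

theorem length_wordAt {A : Type*} (x : ℕ → A) (k n : ℕ) : (wordAt x k n).length = n := by
  simp [wordAt]

theorem wordAt_add {A : Type*} (x : ℕ → A) (k m n : ℕ) :
    wordAt x k (m + n) = wordAt x k m ++ wordAt x (k + m) n := by
  simp only [wordAt, List.ofFn_add, Fin.val_castLE, Fin.val_natAdd, Nat.add_assoc]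

theorem wordAt_succ {A : Type*} (x : ℕ → A) (k n : ℕ) :
    wordAt x k (n + 1) = x k :: wordAt x (k + 1) n := by
  simp [wordAt, List.ofFn_succ, Nat.add_assoc, Nat.add_comm 1]

theorem wordAt_eq_replicate_iff {A : Type*} {x : ℕ → A} {k n : ℕ} {a : A} :
    wordAt x k n = List.replicate n a ↔ ∀ l < n, x (k + l) = a := by
  simp only [List.eq_replicate_iff, length_wordAt, true_and]
  simp only [wordAt, List.forall_mem_ofFn_iff, Fin.forall_iff]

/-- Lets a forbidden word be read gap by gap. Neighbouring gaps share a one: the one closing the gap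
n is the first letter of `gapWord p`. -/
theorem wordAt_eq_gapWord_cons_iff {x : ℕ → Fin 2} {k m n : ℕ} {p : List ℕ} :
    wordAt x k m = gapWord (n :: p) ↔
      IsGap x k n ∧ wordAt x (k + n + 1) (gapWord p).length = gapWord p ∧
        m = n + 1 + (gapWord p).length := by
  have h0 : ∀ j, wordAt x j (gapWord p).length = gapWord p → x j = 1 := by
    intro j hj
    have h : (gapWord p).length = (gapWord p).tail.length + 1 := by simp [gapWord]
    rw [h, wordAt_succ] at hj
    exact (List.cons.inj (hj.trans (by simp [gapWord] :
      gapWord p = 1 :: (gapWord p).tail))).1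
  have h1 : wordAt x k (n + 1 + (gapWord p).length) = gapWord (n :: p) ↔
      IsGap x k n ∧ wordAt x (k + n + 1) (gapWord p).length = gapWord p := by
    rw [wordAt_add, gapWord_cons, wordAt_succ, ← Nat.add_assoc]
    constructor
    · intro h
      obtain ⟨h2, h3⟩ := List.append_inj h (by simp [length_wordAt])
      obtain ⟨h4, h5⟩ := List.cons.inj h2
      exact ⟨⟨h4, wordAt_eq_replicate_iff.1 h5, h0 _ h3⟩, h3⟩
    · rintro ⟨⟨h2, h3, -⟩, h4⟩
      rw [h2, wordAt_eq_replicate_iff.2 h3, h4]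
  constructor
  · intro h
    have hm : m = n + 1 + (gapWord p).length := by
      have := congrArg List.length h
      rw [length_wordAt, gapWord_cons] at this
      simp only [List.length_append, List.length_cons, List.length_replicate] at this
      exact this
    subst hm
    obtain ⟨h2, h3⟩ := h1.1 h
    exact ⟨h2, h3, rfl⟩
  · rintro ⟨h2, h3, rfl⟩
    exact h1.2 ⟨h2, h3⟩

theorem wordAt_eq_gapWord_nil_iff {x : ℕ → Fin 2} {k : ℕ} :
    wordAt x k (gapWord []).length = gapWord [] ↔ x k = 1 := by
  simp [gapWord, wordAt]

/-- A sequence belongs to the ordered prime shift if and only if the gaps between its ones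
are prime and strictly increasing. -/
theorem mem_orderedPrimeShift_iff {x : ℕ → Fin 2} : x ∈ orderedPrimeShift.carrier ↔
    (∀ i n, IsGap x i n → n.Prime) ∧
      ∀ i m n, IsGap x i m → IsGap x (i + m + 1) n → m < n := by
  change (∀ k n, wordAt x k n ∉ primeForbidden) ↔ _
  constructor
  · intro hx
    have hp : ∀ i n, IsGap x i n → n.Prime := by
      intro i n h
      by_contra hn
      exact hx i _ (Or.inl ⟨n, hn, wordAt_eq_gapWord_cons_iff.2
        ⟨h, wordAt_eq_gapWord_nil_iff.2 h.2.2, rfl⟩⟩)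
    refine ⟨hp, fun i m n hm hn => ?_⟩
    by_contra hmn
    -- Two consecutive gaps that fail to increase already form a forbidden word with r = 2.
    refine hx i _ (Or.inr ⟨[m, n], by simp, ?_, ⟨0, by simp, by simpa using hmn⟩,
      wordAt_eq_gapWord_cons_iff.2 ⟨hm, wordAt_eq_gapWord_cons_iff.2
        ⟨hn, wordAt_eq_gapWord_nil_iff.2 hn.2.2, ?_⟩, rfl⟩⟩)
    · simp [hp _ _ hm, hp _ _ hn]
    · rw [gapWord_cons]
      simp only [List.length_append, List.length_cons, List.length_replicate]
  · rintro ⟨hp, hlt⟩ k N (⟨n, hn, h⟩ | ⟨p, -, -, ⟨i, hi, hle⟩, h⟩)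
    · exact hn (hp _ _ (wordAt_eq_gapWord_cons_iff.1 h).1)
    · refine absurd hle (not_le.2 ?_)
      clear hle
      -- Gaps are peeled off the front until the pair at index i comes first, where `hlt` applies.
      induction p generalizing k N i with
      | nil => simp at hi
      | cons a p ih =>
        obtain ⟨h1, h2, -⟩ := wordAt_eq_gapWord_cons_iff.1 h
        rcases i with _ | i
        · rcases p with _ | ⟨b, p⟩
          · simp at hi
          · exact hlt _ _ _ h1 (wordAt_eq_gapWord_cons_iff.1 h2).1
        · exact ih _ _ h2 i (by simpa using hi)

/-! ### Upper bound -/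

/-- The positions of the ones among the first `m` entries of `x`. -/
def onesBelow (x : ℕ → Fin 2) (m : ℕ) : Finset ℕ := (Finset.range m).filter fun i => x i = 1

theorem mem_onesBelow {x : ℕ → Fin 2} {m i : ℕ} : i ∈ onesBelow x m ↔ i < m ∧ x i = 1 := by
  simp [onesBelow]

theorem onesBelow_succ (x : ℕ → Fin 2) (m : ℕ) :
    onesBelow x (m + 1) = if x m = 1 then insert m (onesBelow x m) else onesBelow x m := by
  rw [onesBelow, Finset.range_add_one, Finset.filter_insert]
  rfl

/-- If there are `d + 1` ones below `m` and `j` is the position of the last one, then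
`(d + 1) d ≤ 2 j`, and the gap ending at `j` has length at least `d`. -/
theorem onesBelow_card_aux {x : ℕ → Fin 2} (hx : x ∈ orderedPrimeShift.carrier) (m : ℕ) :
    (onesBelow x m).card = 0 ∨ ∃ d j, (onesBelow x m).card = d + 1 ∧ j < m ∧ x j = 1 ∧
      (∀ l, j < l → l < m → x l = 0) ∧ (d + 1) * d ≤ 2 * j ∧
      (d = 0 ∨ ∃ i n, IsGap x i n ∧ d ≤ n ∧ i + n + 1 = j) := by
  obtain ⟨hp, hlt⟩ := mem_orderedPrimeShift_iff.1 hx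
  induction m with
  | zero => simp [onesBelow]
  | succ m ih =>
    rw [onesBelow_succ]
    split_ifs with hm
    · have hnot : m ∉ onesBelow x m := by simp [mem_onesBelow]
      rw [Finset.card_insert_of_notMem hnot]
      right
      rcases ih with h0 | ⟨d, j, hd, hj, hxj, hz, hle, hgap⟩
      · exact ⟨0, m, by rw [h0], by omega, hm, fun l _ _ => by omega, by omega, Or.inl rfl⟩
      · have hg : IsGap x j (m - j - 1) := by
          refine ⟨hxj, fun l hl => hz _ (by omega) (by omega), ?_⟩
          rwa [show j + (m - j - 1) + 1 = m by omega]
        -- The first gap is prime, so at least 1; a later gap exceeds the one before it, which has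
        -- length at least d.
        have hdn : d + 1 ≤ m - j - 1 := by
          rcases hgap with rfl | ⟨i, n, hin, hdn, rfl⟩
          · exact (hp _ _ hg).one_lt.le
          · exact lt_of_le_of_lt hdn (hlt _ _ _ hin hg)
        refine ⟨d + 1, m, by rw [hd], by omega, hm, fun l _ _ => by omega, ?_,
          Or.inr ⟨j, _, hg, hdn, by omega⟩⟩
        -- The new one lies at m ≥ j + (d + 1) + 1, and twice this increment covers the increase 2(d
        -- + 1) of the product.
        have : (d + 1 + 1) * (d + 1) = (d + 1) * d + 2 * (d + 1) := by ring
        omega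
    · rcases ih with h0 | ⟨d, j, hd, hj, hxj, hz, hle, hgap⟩
      · exact Or.inl h0
      · refine Or.inr ⟨d, j, hd, by omega, hxj, fun l h1 h2 => ?_, hle, hgap⟩
        rcases Nat.lt_succ_iff_lt_or_eq.1 h2 with h | rfl
        · exact hz l h1 h
        · omega

/-- Among the first `m` entries of a sequence in the ordered prime shift there are at most
`√(2m) + 1` ones. -/
theorem card_onesBelow_le {x : ℕ → Fin 2} (hx : x ∈ orderedPrimeShift.carrier) (m : ℕ) :
    (onesBelow x m).card ≤ Nat.sqrt (2 * m) + 1 := by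
  rcases onesBelow_card_aux hx m with h0 | ⟨d, j, hd, hj, -, -, hle, -⟩
  · omega
  · rw [hd]
    refine Nat.succ_le_succ (Nat.le_sqrt.2 ?_)
    nlinarith

/-- Termwise comparison with the binomial expansion of (T + 1)^K, using `T.choose j ≤ T ^ j` and `1
≤ K.choose j`. -/
theorem card_filter_card_le (T K : ℕ) :
    ((Finset.range T).powerset.filter fun s => s.card ≤ K).card ≤ (T + 1) ^ K := by
  have h1 : ((Finset.range T).powerset.filter fun s => s.card ≤ K) ⊆
      (Finset.range (K + 1)).biUnion fun j => (Finset.range T).powersetCard j := by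
    intro s hs
    simp only [Finset.mem_filter, Finset.mem_powerset, Finset.mem_biUnion, Finset.mem_range,
      Finset.mem_powersetCard] at hs ⊢
    exact ⟨s.card, by omega, hs.1, rfl⟩
  refine (Finset.card_le_card h1).trans (Finset.card_biUnion_le.trans ?_)
  rw [add_pow]
  refine Finset.sum_le_sum fun j hj => ?_
  have hj' : j ≤ K := by simpa [Nat.lt_succ_iff] using hj
  rw [Finset.card_powersetCard, Finset.card_range, one_pow, mul_one]
  exact (Nat.choose_le_pow T j).trans (Nat.le_mul_of_pos_right _ (Nat.choose_pos hj'))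

open ArrowGroupoid RenaultDeaconu in
-- An arrow over u is encoded by m, n and the positions of the ones among the first m letters of x.
-- The exponent is K + 2: K bounds the number of ones, and m and n each contribute one more factor.
theorem encard_ball_le (u : Cover (RenaultDeaconu orderedPrimeShift)) (t : ℝ) :
    (ball primeCoverLength u t).encard ≤
      ((⌊t⌋₊ + 2) ^ (Nat.sqrt (2 * (⌊t⌋₊ + 1)) + 3) : ℕ) := by
  set T := ⌊t⌋₊ + 1 with hT
  set K := Nat.sqrt (2 * T) + 1 with hK
  have hex : ∀ p ∈ ball primeCoverLength u t, ∃ m n : ℕ, m < T ∧ n < T ∧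
      p.1.1.lag = (m : ℤ) - n ∧ shiftMap^[m] p.1.1.left.1 = shiftMap^[n] p.1.1.right.1 := by
    rintro p ⟨-, hp⟩
    obtain ⟨k, hk, hg⟩ := exists_mem_setPow_wordLength exists_mem_setPow_generators p.1.1
    have hkt : k ≤ ⌊t⌋₊ := Nat.le_floor (hk.symm.le.trans hp)
    obtain ⟨m, n, hm, hn, h⟩ := exists_tail_eq_of_mem_setPow hg
    exact ⟨m, n, by omega, by omega, h⟩
  choose! m n hm hn hlag htail using hex
  let F : Finset (Finset ℕ) := (Finset.range T).powerset.filter fun s => s.card ≤ K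
  let B : Finset (ℕ × ℕ × Finset ℕ) := Finset.range T ×ˢ Finset.range T ×ˢ F
  have h1 : MapsTo (fun p : Cover (RenaultDeaconu orderedPrimeShift) =>
      (m p, n p, onesBelow p.1.1.left.1 (m p))) (ball primeCoverLength u t) B := by
    intro p hp
    have hmT := hm p hp
    simp only [B, F, Finset.coe_product, Set.mem_prod, Finset.mem_coe, Finset.mem_range,
      Finset.mem_filter, Finset.mem_powerset]
    refine ⟨hmT, hn p hp, fun i hi => ?_, (card_onesBelow_le p.1.1.left.2 _).trans ?_⟩
    · have := (mem_onesBelow.1 hi).1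
      exact Finset.mem_range.2 (by omega)
    · exact Nat.succ_le_succ (Nat.sqrt_le_sqrt (by omega))
  have h2 : InjOn (fun p : Cover (RenaultDeaconu orderedPrimeShift) =>
      (m p, n p, onesBelow p.1.1.left.1 (m p))) (ball primeCoverLength u t) := by
    intro p hp q hq e
    obtain ⟨e1, e2, e3⟩ : m p = m q ∧ n p = n q ∧
        onesBelow p.1.1.left.1 (m p) = onesBelow q.1.1.left.1 (m q) := by
      simpa only [Prod.mk.injEq] using e
    -- The common source fixes the right end y and the point A. The lag is m - n, and beyond its
    -- first m letters x agrees with the tail of y.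
    have e4 : s p = s q := hp.1.trans hq.1.symm
    have e5 : (s p).1.1.right = (s q).1.1.right := congrArg (fun z => z.1.1.right) e4
    have e5' : p.1.1.right = q.1.1.right := e5
    have e6 : (s p).1.2 = (s q).1.2 := congrArg (fun z => z.1.2) e4
    have e7 := htail p hp
    rw [e1, e2, e5', ← htail q hq] at e7
    refine Subtype.ext (Prod.ext (RenaultDeaconu.ext (Subtype.ext (funext fun i => ?_))
      (by rw [hlag p hp, hlag q hq, e1, e2]) e5') e6)
    rcases lt_or_ge i (m q) with hi | hi
    · have e8 : p.1.1.left.1 i = 1 ↔ q.1.1.left.1 i = 1 := by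
        have := congrArg (i ∈ ·) e3
        simpa [mem_onesBelow, e1, hi] using this
      omega
    · have h := congrFun e7 (i - m q)
      simpa only [shiftMap_iterate, Nat.sub_add_cancel hi] using h
  refine (Set.encard_le_encard_of_injOn h1 h2).trans ?_
  rw [Set.encard_coe_eq_coe_finsetCard]
  refine Nat.cast_le.2 ?_
  calc B.card = T * (T * F.card) := by simp [B]
    _ ≤ (T + 1) * ((T + 1) * (T + 1) ^ K) := by
      gcongr
      · omega
      · omega
      · exact card_filter_card_le T K
    _ = _ := by
      rw [show ⌊t⌋₊ + 2 = T + 1 by omega, show Nat.sqrt (2 * T) + 3 = K + 2 by omega]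
      ring

/-- With S = ⌊t⌋ + 2, the exponent is at most 5 S^(1/2) and log S ≤ 4 S^(1/4), so the logarithm of
the power is at most 20 S^(3/4). Subadditivity of the power 3/4 then turns S into t at the cost of
the constant 40. -/
theorem pow_sqrt_le_exp {t : ℝ} (ht : 0 ≤ t) :
    (((⌊t⌋₊ + 2) ^ (Nat.sqrt (2 * (⌊t⌋₊ + 1)) + 3) : ℕ) : ℝ) ≤
      Real.exp 40 * Real.exp (20 * t ^ (3 / 4 : ℝ)) := by
  set S : ℕ := ⌊t⌋₊ + 2 with hS
  have hS1 : (1 : ℝ) ≤ S := by rw [hS]; push_cast; linarith [Nat.cast_nonneg (α := ℝ) ⌊t⌋₊]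
  have hS0 : (0 : ℝ) < S := by linarith
  have h1 : ((Nat.sqrt (2 * (⌊t⌋₊ + 1)) + 3 : ℕ) : ℝ) ≤ 5 * (S : ℝ) ^ (1 / 2 : ℝ) := by
    have h2 : ((Nat.sqrt (2 * (⌊t⌋₊ + 1)) : ℕ) : ℝ) ≤ 2 * √(S : ℝ) := by
      have h3 : Nat.sqrt (2 * (⌊t⌋₊ + 1)) ^ 2 ≤ 4 * S := (Nat.sqrt_le' _).trans (by omega)
      have h4 : ((Nat.sqrt (2 * (⌊t⌋₊ + 1)) : ℕ) : ℝ) ^ 2 ≤ 4 * S := by exact_mod_cast h3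
      refine abs_le_of_sq_le_sq' ?_ (by positivity) |>.2
      rw [mul_pow, Real.sq_sqrt hS0.le]
      linarith
    have h5 : 1 ≤ √(S : ℝ) := Real.one_le_sqrt.2 hS1
    rw [← Real.sqrt_eq_rpow]
    push_cast
    linarith
  have h2 : Real.log S ≤ 4 * (S : ℝ) ^ (1 / 4 : ℝ) := by
    have := Real.log_le_rpow_div hS0.le (ε := 1 / 4) (by norm_num)
    linarith
  have h3 : (S : ℝ) ^ (3 / 4 : ℝ) ≤ t ^ (3 / 4 : ℝ) + 2 := by
    have h4 : (S : ℝ) ≤ t + 2 := by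
      rw [hS]
      push_cast
      linarith [Nat.floor_le ht]
    calc (S : ℝ) ^ (3 / 4 : ℝ) ≤ (t + 2) ^ (3 / 4 : ℝ) := by gcongr
      _ ≤ t ^ (3 / 4 : ℝ) + 2 ^ (3 / 4 : ℝ) :=
        Real.rpow_add_le_add_rpow ht (by norm_num) (by norm_num) (by norm_num)
      _ ≤ t ^ (3 / 4 : ℝ) + 2 := by
        gcongr
        exact Real.rpow_le_self_of_one_le (by norm_num) (by norm_num)
  push_cast
  rw [← Real.exp_add, ← Real.exp_log (pow_pos hS0 _), Real.log_pow]
  refine Real.exp_le_exp.2 ?_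
  calc ((Nat.sqrt (2 * (⌊t⌋₊ + 1)) + 3 : ℕ) : ℝ) * Real.log S
      ≤ (5 * (S : ℝ) ^ (1 / 2 : ℝ)) * (4 * (S : ℝ) ^ (1 / 4 : ℝ)) :=
        mul_le_mul h1 h2 (Real.log_nonneg hS1) (by positivity)
    _ = 20 * (S : ℝ) ^ (3 / 4 : ℝ) := by
      rw [show (3 / 4 : ℝ) = 1 / 2 + 1 / 4 by norm_num, Real.rpow_add hS0]
      ring
    _ ≤ 40 + 20 * t ^ (3 / 4 : ℝ) := by linarith

theorem hasStrongSubexponentialGrowth_primeCoverLength :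
    ArrowGroupoid.HasStrongSubexponentialGrowth primeCoverLength := by
  refine ⟨20, 3 / 4, Real.exp 40, by norm_num, by norm_num, by norm_num, Real.exp_pos _,
    fun t ht => iSup₂_le fun u _ => ?_⟩
  have h1 : ((ArrowGroupoid.ball primeCoverLength u t).encard : ℝ≥0∞) ≤
      (((⌊t⌋₊ + 2) ^ (Nat.sqrt (2 * (⌊t⌋₊ + 1)) + 3) : ℕ) : ℝ≥0∞) := by
    exact_mod_cast ENat.toENNReal_le.2 (encard_ball_le u t)
  refine h1.trans ?_
  rw [← ENNReal.ofReal_natCast]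
  exact ENNReal.ofReal_le_ofReal (pow_sqrt_le_exp ht)

/-! ### Lower bound -/

/-- The sum of `q + 1` over the elements `q < p` of `T`. -/
def onePos (T : Finset ℕ) (p : ℕ) : ℕ := ∑ q ∈ T.filter (· < p), (q + 1)

theorem onePos_mono (T : Finset ℕ) : Monotone (onePos T) := fun _ _ hab =>
  Finset.sum_le_sum_of_subset (Finset.monotone_filter_right T fun _ _ h => lt_of_lt_of_le h hab)

theorem onePos_succ (T : Finset ℕ) (p : ℕ) :
    onePos T (p + 1) = onePos T p + if p ∈ T then p + 1 else 0 := by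
  have h : T.filter (· < p + 1) = T.filter (· < p) ∪ T.filter (· = p) := by
    rw [← Finset.filter_or]
    exact Finset.filter_congr fun q _ => by omega
  rw [onePos, h, Finset.sum_union, onePos, Finset.filter_eq']
  · split_ifs <;> simp
  · exact Finset.disjoint_filter.2 fun q _ h1 h2 => by omega

theorem onePos_le (T : Finset ℕ) (p : ℕ) : onePos T p ≤ ∑ q ∈ T, (q + 1) :=
  Finset.sum_le_sum_of_subset (Finset.filter_subset _ _)

open Classical in
/-- The sequence `1 0^(q₁) 1 0^(q₂) 1 … 0^(qᵣ) 1 0 0 …`, where `q₁ < q₂ < … < qᵣ` are the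
elements of `T`. -/
noncomputable def gapSeq (T : Finset ℕ) (i : ℕ) : Fin 2 := if ∃ p, onePos T p = i then 1 else 0

theorem gapSeq_eq_one_iff {T : Finset ℕ} {i : ℕ} : gapSeq T i = 1 ↔ ∃ p, onePos T p = i := by
  simp [gapSeq]

theorem gapSeq_eq_zero_iff {T : Finset ℕ} {i : ℕ} : gapSeq T i = 0 ↔ ¬ ∃ p, onePos T p = i := by
  simp [gapSeq]

/-- `onePos T` is monotone and jumps only when passing an element p of T, by p + 1. So consecutive
ones are exactly the two sides of such a jump. -/
theorem isGap_gapSeq_iff {T : Finset ℕ} {i n : ℕ} :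
    IsGap (gapSeq T) i n ↔ n ∈ T ∧ onePos T n = i := by
  constructor
  · rintro ⟨h1, h2, h3⟩
    obtain ⟨a, ha⟩ := gapSeq_eq_one_iff.1 h1
    obtain ⟨b, hb⟩ := gapSeq_eq_one_iff.1 h3
    have hex : ∃ c, i < onePos T c := ⟨b, by omega⟩
    classical
    -- c = q + 1 is the first argument at which `onePos T` exceeds i, so the jump away from i
    -- happens at q.
    obtain ⟨c, hc, hmin⟩ : ∃ c, i < onePos T c ∧ ∀ c', i < onePos T c' → c ≤ c' :=
      ⟨Nat.find hex, Nat.find_spec hex, fun _ h => Nat.find_min' hex h⟩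
    rcases c with _ | q
    · simp [onePos] at hc
    have hq : onePos T q ≤ i := not_lt.1 fun h => by have := hmin q h; omega
    have haq : a ≤ q := by
      by_contra h
      have := onePos_mono T (show q + 1 ≤ a by omega)
      omega
    have hqi : onePos T q = i := le_antisymm hq (ha ▸ onePos_mono T haq)
    have hsucc := onePos_succ T q
    split_ifs at hsucc with hqT
    · have hqb := onePos_mono T (hmin b (by omega))
      have hqn : q = n := by
        -- The next one is at i + q + 1, not beyond i + n + 1. If q ≠ n, it would fall inside the
        -- run of zeros.
        by_contra hne
        have h0 := gapSeq_eq_zero_iff.1 (h2 q (by omega))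
        exact h0 ⟨q + 1, by omega⟩
      exact hqn ▸ ⟨hqT, hqi⟩
    · omega
  · rintro ⟨hn, rfl⟩
    have hsucc := onePos_succ T n
    rw [if_pos hn] at hsucc
    refine ⟨gapSeq_eq_one_iff.2 ⟨n, rfl⟩, fun l hl => gapSeq_eq_zero_iff.2 ?_,
      gapSeq_eq_one_iff.2 ⟨n + 1, hsucc⟩⟩
    rintro ⟨p, hp⟩
    rcases le_or_gt p n with h | h
    · have := onePos_mono T h
      omega
    · have := onePos_mono T (show n + 1 ≤ p from h)
      omega

/-- T is recovered as the set of gap lengths. -/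
theorem gapSeq_injective : Function.Injective gapSeq := by
  intro T T' h
  ext n
  have h1 : ∀ S : Finset ℕ, n ∈ S ↔ ∃ i, IsGap (gapSeq S) i n := fun S => by
    simp [isGap_gapSeq_iff]
  rw [h1, h1, h]

theorem gapSeq_mem {T : Finset ℕ} (hT : ∀ q ∈ T, q.Prime) :
    gapSeq T ∈ orderedPrimeShift.carrier := by
  refine mem_orderedPrimeShift_iff.2 ⟨fun i n h => hT n (isGap_gapSeq_iff.1 h).1,
    fun i m n hm hn => ?_⟩
  have h1 := (isGap_gapSeq_iff.1 hm).2
  have h2 := (isGap_gapSeq_iff.1 hn).2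
  by_contra h
  have := onePos_mono T (not_lt.1 h)
  omega

/-- No one lies beyond position ∑ (q + 1); the extra shift removes a one at that position. -/
theorem shiftMap_iterate_gapSeq (T : Finset ℕ) :
    shiftMap^[∑ q ∈ T, (q + 1) + 1] (gapSeq T) = 0 := by
  funext i
  rw [RenaultDeaconu.shiftMap_iterate]
  refine gapSeq_eq_zero_iff.2 ?_
  rintro ⟨p, hp⟩
  have := onePos_le T p
  omega

theorem zero_mem_orderedPrimeShift : (0 : ℕ → Fin 2) ∈ orderedPrimeShift.carrier :=
  mem_orderedPrimeShift_iff.2 ⟨fun _ _ h => absurd h.1 (by simp),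
    fun _ _ _ h => absurd h.1 (by simp)⟩

open ArrowGroupoid in
-- Distinct k-subsets of the primes up to N give distinct arrows over the zero sequence, and
-- shifting away at most k gaps and the last one costs at most k(N + 1) + 1 generators.
theorem choose_le_maxBall (N k : ℕ) : ((N.primeCounting.choose k : ℕ) : ℝ≥0∞) ≤
    maxBall primeCoverLength (k * (N + 1) + 1 : ℕ) := by
  let o : orderedPrimeShift.carrier := ⟨0, zero_mem_orderedPrimeShift⟩
  let e : RenaultDeaconu orderedPrimeShift := ⟨o, 0, o, 0, 0, by simp, rfl⟩
  have hA : closedFibre e ∈ limitFibres (RenaultDeaconu orderedPrimeShift) :=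
    subset_closure ⟨e, rfl, rfl⟩
  let u : Cover (RenaultDeaconu orderedPrimeShift) := ⟨(e, closedFibre e), hA, rfl⟩
  have hprime : ∀ T : Finset ℕ, ∀ q ∈ T.filter Nat.Prime, q.Prime := fun T q hq =>
    (Finset.mem_filter.1 hq).2
  -- Filtering by primality makes g total; on P it changes nothing.
  let g : Finset ℕ → RenaultDeaconu orderedPrimeShift := fun T =>
    ⟨⟨gapSeq (T.filter Nat.Prime), gapSeq_mem (hprime T)⟩,
      (∑ q ∈ T.filter Nat.Prime, (q + 1) + 1 : ℕ), o,
      _, 0, by simp, shiftMap_iterate_gapSeq _⟩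
  let f : Finset ℕ → Cover (RenaultDeaconu orderedPrimeShift) := fun T =>
    ⟨(g T, closedFibre e), hA, rfl⟩
  let P : Finset (Finset ℕ) := ((Finset.range (N + 1)).filter Nat.Prime).powersetCard k
  have hfilter : ∀ T ∈ P, T.filter Nat.Prime = T := fun T hT =>
    Finset.filter_true_of_mem fun q hq =>
      (Finset.mem_filter.1 ((Finset.mem_powersetCard.1 hT).1 hq)).2
  -- The base point is written `s u` because `r_s` shows at once that it is a unit.
  have h1 : MapsTo f P (ball primeCoverLength (s u) ((k * (N + 1) + 1 : ℕ) : ℝ)) := by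
    intro T hT
    refine ⟨rfl, ?_⟩
    have hg : g T ∈ setPow (RenaultDeaconu.generators orderedPrimeShift)
        (∑ q ∈ T.filter Nat.Prime, (q + 1) + 1 + 0) :=
      RenaultDeaconu.mem_setPow_generators (by simp [g]) (shiftMap_iterate_gapSeq _)
    refine (wordLength_le hg).trans (Nat.cast_le.2 ?_)
    rw [hfilter T hT, Nat.add_zero]
    obtain ⟨hsub, hcard⟩ := Finset.mem_powersetCard.1 hT
    refine Nat.succ_le_succ ((Finset.sum_le_card_nsmul T _ (N + 1) fun q hq => ?_).trans ?_)
    · exact Finset.mem_range.1 (Finset.mem_filter.1 (hsub hq)).1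
    · rw [hcard, smul_eq_mul]
  have h2 : InjOn f P := by
    intro T hT T' hT' h
    have h3 : gapSeq (T.filter Nat.Prime) = gapSeq (T'.filter Nat.Prime) :=
      congrArg (fun z : Cover (RenaultDeaconu orderedPrimeShift) => z.1.1.left.1) h
    rwa [hfilter T hT, hfilter T' hT', gapSeq_injective.eq_iff] at h3
  have h3 := Set.encard_le_encard_of_injOn h1 h2
  rw [Set.encard_coe_eq_coe_finsetCard, Finset.card_powersetCard,
    ← Nat.count_eq_card_filter_range] at h3
  refine le_trans ?_ (le_iSup₂ (f := fun (u : Cover (RenaultDeaconu orderedPrimeShift))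
    (_ : u ∈ unitSpace _) => ((ball primeCoverLength u ((k * (N + 1) + 1 : ℕ) : ℝ)).encard : ℝ≥0∞))
    (s u) (ArrowGroupoid.r_s u))
  exact_mod_cast ENat.toENNReal_le.2 h3

/-- A crude consequence of Chebyshev's bound. M ≥ 600 gives 24√(M + 1) ≤ M, hence log(M + 1) ≤ M/12
and (M + k) log(M²) ≤ M²/3, which `Chebyshev.pi_ge` absorbs. The summand k leaves room for
`Nat.pow_le_choose`. -/
theorem add_le_primeCounting_sq {k M : ℕ} (hk : k ≤ M) (hM : 600 ≤ M) :
    M + k ≤ (M ^ 2).primeCounting := by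
  have hM' : (600 : ℝ) ≤ M := by exact_mod_cast hM
  have hk' : (k : ℝ) ≤ M := by exact_mod_cast hk
  have h1 : Real.log (M + 1) ≤ 2 * √((M : ℝ) + 1) := by
    have := Real.log_le_rpow_div (x := (M : ℝ) + 1) (by positivity) (ε := 1 / 2) (by norm_num)
    rw [Real.sqrt_eq_rpow]
    linarith
  have h2 : 24 * √((M : ℝ) + 1) ≤ M := by
    refine abs_le_of_sq_le_sq' ?_ (by positivity) |>.2
    rw [mul_pow, Real.sq_sqrt (by positivity)]
    nlinarith
  have h3 : Real.log ((M ^ 2 : ℕ) + 1 : ℝ) ≤ 2 * Real.log (M + 1) := by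
    rw [← Real.log_rpow (by positivity)]
    refine Real.log_le_log (by positivity) ?_
    push_cast
    norm_num
    nlinarith
  have h4 : Real.log ((M ^ 2 : ℕ) : ℝ) ≤ 2 * Real.log (M + 1) :=
    (Real.log_le_log (by positivity) (by linarith)).trans h3
  have h5 : 0 < Real.log ((M ^ 2 : ℕ) : ℝ) := Real.log_pos (by push_cast; nlinarith)
  have h6 := Chebyshev.pi_ge (M ^ 2)
  have h7 := Real.log_two_gt_d9
  have h8 : ((M + k : ℕ) : ℝ) ≤ ((M ^ 2).primeCounting : ℝ) := by
    refine le_trans ?_ h6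
    rw [le_div_iff₀ h5]
    have h9 : ((M + k : ℕ) : ℝ) * Real.log ((M ^ 2 : ℕ) : ℝ) ≤ (2 * M) * (2 * Real.log (M + 1)) :=
      mul_le_mul (by push_cast; linarith) h4 h5.le (by positivity)
    have h10 : Real.log (M + 1) ≤ M / 12 := by linarith
    push_cast at h3 h9 ⊢
    nlinarith
  exact_mod_cast h8

theorem not_hasPolynomialGrowth_primeCoverLength :
    ¬ ArrowGroupoid.HasPolynomialGrowth primeCoverLength := by
  rintro ⟨C, hC, d, h⟩
  -- At radius of order M² a bound of degree d allows only a multiple of M^(2d), while the ball has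
  -- at least M^k / k! elements; so k exceeds 2d by one.
  set k := 2 * d + 1 with hk
  -- M must exceed k and 600 for the prime count, and the constant k! C (2k + 2)^d left after
  -- cancelling M^(2d).
  obtain ⟨M, hM⟩ := exists_nat_gt (max (max (k : ℝ) 600) (k.factorial * (C * (2 * k + 2) ^ d)))
  have hMk : k ≤ M := by exact_mod_cast ((le_max_left _ _).trans (le_max_left _ _)).trans hM.le
  have hM6 : 600 ≤ M := by
    exact_mod_cast ((le_max_right (k : ℝ) 600).trans (le_max_left _ _)).trans hM.le
  have hMC : k.factorial * (C * (2 * k + 2) ^ d) < (M : ℝ) := (le_max_right _ _).trans_lt hM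
  have hM6' : (600 : ℝ) ≤ M := by exact_mod_cast hM6
  have h1 := (choose_le_maxBall (M ^ 2) k).trans (h _ (Nat.cast_nonneg _))
  rw [← ENNReal.ofReal_natCast, ENNReal.ofReal_le_ofReal_iff (by positivity)] at h1
  have h2 : (M : ℝ) ^ k / k.factorial ≤ ((M ^ 2).primeCounting.choose k : ℝ) := by
    refine le_trans ?_ (Nat.pow_le_choose k (M ^ 2).primeCounting)
    have := add_le_primeCounting_sq hMk hM6
    gcongr
    omega
  have h3 : (1 + ((k * (M ^ 2 + 1) + 1 : ℕ) : ℝ)) ^ d ≤ ((2 * k + 2) * (M : ℝ) ^ 2) ^ d := by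
    gcongr
    push_cast
    have : (0 : ℝ) ≤ k := Nat.cast_nonneg k
    nlinarith [mul_nonneg this (show (0 : ℝ) ≤ (M : ℝ) ^ 2 - 1 by nlinarith)]
  have h4 : (M : ℝ) ^ k ≤ k.factorial * (C * (2 * k + 2) ^ d) * (M : ℝ) ^ (2 * d) := by
    rw [div_le_iff₀ (by positivity)] at h2
    calc (M : ℝ) ^ k ≤ ((M ^ 2).primeCounting.choose k : ℝ) * k.factorial := h2
      _ ≤ (C * ((2 * k + 2) * (M : ℝ) ^ 2) ^ d) * k.factorial := by
        gcongr
        exact h1.trans (by gcongr)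
      _ = _ := by
        rw [mul_pow, ← pow_mul]
        ring
  rw [hk, pow_succ, mul_comm ((M : ℝ) ^ (2 * d)), ← hk] at h4
  exact absurd (le_of_mul_le_mul_right h4 (by positivity)) (not_le.2 hMC)

theorem mainTheorem2 :
    ArrowGroupoid.IsEtale (ArrowGroupoid.Cover (RenaultDeaconu orderedPrimeShift)) ∧
    ArrowGroupoid.IsLengthFunction primeCoverLength ∧
    ArrowGroupoid.IsLocallyBounded primeCoverLength ∧
    ArrowGroupoid.HasStrongSubexponentialGrowth primeCoverLength ∧
    ¬ ArrowGroupoid.HasPolynomialGrowth primeCoverLength :=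
  ⟨ArrowGroupoid.Cover.isEtale RenaultDeaconu.isLocallyInjective_s,
    ArrowGroupoid.Cover.isLengthFunction RenaultDeaconu.isLengthFunction_wordLength_generators,
    ArrowGroupoid.Cover.isLocallyBounded RenaultDeaconu.isLocallyBounded_wordLength_generators,
    hasStrongSubexponentialGrowth_primeCoverLength, not_hasPolynomialGrowth_primeCoverLength⟩
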